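/- Let $\mathbb F_q$ be a finite field with $q$ elements and let $\mathbb N=\{1,2,3,\dots\}$. Let $\Gamma=\{x_{n,\varepsilon} : n\in\mathbb N,\ \varepsilon\in\mathbb F_q^\times\}$ be the alphabet with weights $w(x_{n,\varepsilon})=n$, let $\langle\Gamma\rangle$ be the set of words over $\Gamma$ (the empty word is denoted by $1$; the depth of a word is its number of letters), and let $\mathfrak D$ be the $\mathbb F_q$-vector space with basis $\langle\Gamma\rangle$. Put $x_n:=x_{n,1}$. For $r,s,i\in\mathbb N$ let $$\Delta^i_{r,s}=\begin{cases}(-1)^{r-1}\binom{i-1}{r-1}+(-1)^{s-1}\binom{i-1}{s-1} & \text{if } (q-1)\mid i,\\ 0&\text{otherwise,}\end{cases}$$ regarded as an element of $\mathbb F_q$. *Products.* The $\mathbb F_q$-bilinear products $\diamond$ and $⧢$ on $\mathfrak D$ are defined recursively by $1\diamond\mathfrak a=\mathfrak a\diamond1=\mathfrak a$, $1⧢\mathfrak a=\mathfrak a⧢1=\mathfrak a$ and, for nonempty words $\mathfrak a=x_{a,\alpha}\mathfrak a_-$ and $\mathfrak b=x_{b,\beta}\mathfrak b_-$, $$\mathfrak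 a\diamond\mathfrak b=x_{a+b,\alpha\beta}(\mathfrak a_-⧢\mathfrak b_-)+\sum_{\substack{i+j=a+b\\ i,j\ge1}}\Delta^j_{a,b}\,x_{i,\alpha\beta}\bigl(x_{j,1}⧢(\mathfrak a_-⧢\mathfrak b_-)\bigr),$$ $$\mathfrak a⧢\mathfrak b=x_{a,\alpha}(\mathfrak a_-⧢\mathfrak b)+x_{b,\beta}(\mathfrak a⧢\mathfrak b_-)+\mathfrak a\diamond\mathfrak b .$$ The $\mathbb F_q$-bilinear product $\triangleright$ on $\mathfrak D$ is defined by $1\triangleright\mathfrak a=\mathfrak a\triangleright1=\mathfrak a$ and $x_{a,\alpha}\mathfrak a_-\triangleright\mathfrak b=x_{a,\alpha}(\mathfrak a_-⧢\mathfrak b)$ for nonempty words $x_{a,\alpha}\mathfrak a_-$ and $\mathfrak b$. On $\mathfrak D\otimes\mathfrak D$ put $(a\otimes b)⧢(a'\otimes b')=(a⧢a')\otimes(b⧢b')$, extended bilinearly. *Coproduct.* For a word $\mathfrak a=x_{i_1}\cdots x_{i_m}$ in the letters $x_n$ $(n\in\mathbb N)$ put $$[\mathfrak a]=(-1)^m\,\Delta^{i_1}_{1,w(\mathfrak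 a)+1}\cdots\Delta^{i_m}_{1,w(\mathfrak a)+1}\;x_{i_1}⧢\cdots⧢x_{i_m},\qquad [1]=1,$$ where $w(\mathfrak a)=i_1+\dots+i_m$. The $\mathbb F_q$-linear map $\Delta:\mathfrak D\to\mathfrak D\otimes\mathfrak D$ is defined on words by induction on the depth: $\Delta(1)=1\otimes1$; for letters $$\Delta(x_{n,\varepsilon})=1\otimes x_{n,\varepsilon}+\Delta'(x_{n,\varepsilon}),\qquad \Delta'(x_{n,\varepsilon})=\sum_{r+w(\mathfrak a)=n}\binom{r+\operatorname{depth}(\mathfrak a)-2}{\operatorname{depth}(\mathfrak a)}\,x_{r,\varepsilon}\otimes[\mathfrak a],$$ the sum being over all $r\in\mathbb N$ and all (possibly empty) words $\mathfrak a$ in the letters $x_k$, $k\in\mathbb N$, with $r+w(\mathfrak a)=n$ (and $\binom{-1}{0}=1$); and for a word $x_{n,\varepsilon}\mathfrak v$ with $\mathfrak v$ nonempty, writing $\Delta'(x_{n,\varepsilon})=\sum a\otimes b$ and $\Delta(\mathfrak v)=\sum a_{\mathfrak v}\otimes b_{\mathfrak v}$, $$\Delta(x_{n,\varepsilon}\mathfrak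 v)=1\otimes x_{n,\varepsilon}\mathfrak v+\sum (a\triangleright a_{\mathfrak v})\otimes(b⧢b_{\mathfrak v}).$$ **Theorem.** For all words $\mathfrak u,\mathfrak v\in\langle\Gamma\rangle$, $$\Delta(\mathfrak u⧢\mathfrak v)=\Delta(\mathfrak u)⧢\Delta(\mathfrak v).$$ -/

import Mathlib

open scoped TensorProduct

noncomputable section

namespace AMZV

/-- A letter `x_{n, ε}` with `n ≥ 1` and `ε ∈ 𝔽_q^×`; it has weight `n`. -/
abbrev Letter (F : Type*) [Field F] : Type _ := ℕ+ × Fˣ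

/-- The words `⟨Γ⟩`; the empty word `1` is the empty list, the depth is the length. -/
abbrev Word (F : Type*) [Field F] : Type _ := List (Letter F)

/-- The `𝔽_q`-vector space `𝔇` with basis `⟨Γ⟩`. -/
abbrev WordSpace (F : Type*) [Field F] : Type _ := Word F →₀ F

variable {F : Type*} [Field F]

/-- A word, seen as a basis vector of `𝔇`. -/
def word (u : Word F) : WordSpace F := Finsupp.single u 1

/-- Left concatenation with a letter, `𝔞 ↦ x 𝔞`, extended linearly. -/
def consLetter (x : Letter F) : WordSpace F →ₗ[F] WordSpace F :=
  Finsupp.lmapDomain F F (List.cons x)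

/-- The bilinear extension of a product defined on words. -/
def bilinExt (f : Word F → Word F → WordSpace F) :
    WordSpace F →ₗ[F] WordSpace F →ₗ[F] WordSpace F :=
  Finsupp.linearCombination F fun u => Finsupp.linearCombination F (f u)

/-- The pairs `(i, j)` of positive integers with `i + j = n`. -/
def pairsWithSum (n : ℕ+) : Finset (ℕ+ × ℕ+) :=
  (Finset.Icc 1 n ×ˢ Finset.Icc 1 n).filter fun p => p.1 + p.2 = n

theorem mem_pairsWithSum (n : ℕ+) (p : ℕ+ × ℕ+) : p ∈ pairsWithSum n ↔ p.1 + p.2 = n := by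
  unfold pairsWithSum
  simp only [Finset.mem_filter, Finset.mem_product, Finset.mem_Icc, one_le, true_and,
    and_iff_right_iff_imp]
  rintro rfl
  exact ⟨(PNat.lt_add_right _ _).le, (PNat.lt_add_left _ _).le⟩

/-- The words over `Σ = {x_n}` (lists of positive integers) of weight `m`. -/
def sigmaWords (m : ℕ) : Finset (List ℕ+) :=
  (Finset.univ : Finset (Composition m)).image fun c => c.blocks.map Nat.toPNat'

theorem mem_sigmaWords (m : ℕ) (a : List ℕ+) :
    a ∈ sigmaWords m ↔ (a.map fun i : ℕ+ => (i : ℕ)).sum = m := by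
  unfold sigmaWords
  simp only [Finset.mem_image, Finset.mem_univ, true_and]
  constructor
  · rintro ⟨c, rfl⟩
    rw [List.map_map]
    refine Eq.trans ?_ c.blocks_sum
    congr 1
    refine (List.map_congr_left fun i hi => ?_).trans (List.map_id _)
    have hp := c.blocks_pos hi
    simp [Nat.toPNat'_coe, hp]
  · intro h
    refine ⟨⟨a.map fun i : ℕ+ => (i : ℕ), ?_, h⟩, ?_⟩
    · intro i hi
      obtain ⟨k, -, rfl⟩ := List.mem_map.1 hi
      exact k.pos
    · rw [List.map_map]
      refine (List.map_congr_left fun i _ => ?_).trans (List.map_id _)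
      exact PNat.coe_toPNat' i

/-- The span of the words of depth at most `d`. -/
def depthLE (F : Type*) [Field F] (d : ℕ) : Submodule F (WordSpace F) :=
  Finsupp.supported F F {w : Word F | w.length ≤ d}

theorem word_mem_depthLE {u : Word F} {d : ℕ} (h : u.length ≤ d) : word u ∈ depthLE F d :=
  Finsupp.single_mem_supported F 1 h

theorem depthLE_mono {d e : ℕ} (h : d ≤ e) : depthLE F d ≤ depthLE F e :=
  Finsupp.supported_mono fun _ hw => le_trans hw h

theorem consLetter_mem {x : Letter F} {s : WordSpace F} {d : ℕ} (hs : s ∈ depthLE F d) :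
    consLetter x s ∈ depthLE F (d + 1) := by
  have h : depthLE F d ≤ (depthLE F (d + 1)).comap (consLetter x) := by
    unfold depthLE
    rw [Finsupp.supported_eq_span_single, Submodule.span_le]
    rintro _ ⟨w, hw, rfl⟩
    have hw' : w.length ≤ d := hw
    have e : consLetter x (Finsupp.single w (1 : F)) = word (x :: w) := by
      simp [consLetter, word, Finsupp.lmapDomain_apply, Finsupp.mapDomain_single]
    rw [SetLike.mem_coe, Submodule.mem_comap, e]
    exact word_mem_depthLE (by simpa using hw')
  exact h hs

theorem bilinExt_word (f : Word F → Word F → WordSpace F) (u v : Word F) :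
    bilinExt f (word u) (word v) = f u v := by
  simp [bilinExt, word]

theorem bilinExt_word_left (f : Word F → Word F → WordSpace F) (u : Word F) :
    bilinExt f (word u) = Finsupp.linearCombination F (f u) := by
  simp [bilinExt, word]

theorem bilinExt_mem {f : Word F → Word F → WordSpace F}
    (hf : ∀ u v, f u v ∈ depthLE F (u.length + v.length)) (u : Word F) {s : WordSpace F} {d : ℕ}
    (hs : s ∈ depthLE F d) : bilinExt f (word u) s ∈ depthLE F (u.length + d) := by
  rw [bilinExt_word_left, Finsupp.linearCombination_apply]
  refine Submodule.sum_mem _ fun w hw => Submodule.smul_mem _ _ ?_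
  have hw' : w.length ≤ d := (Finsupp.mem_supported F s).1 hs hw
  exact depthLE_mono (by lia) (hf u w)

theorem bilinExt_congr {f g : Word F → Word F → WordSpace F} (u : Word F) {s : WordSpace F} {d : ℕ}
    (hs : s ∈ depthLE F d) (h : ∀ w : Word F, w.length ≤ d → f u w = g u w) :
    bilinExt f (word u) s = bilinExt g (word u) s := by
  rw [bilinExt_word_left, bilinExt_word_left, Finsupp.linearCombination_apply,
    Finsupp.linearCombination_apply]
  refine Finset.sum_congr rfl fun w hw => ?_
  have e := h w ((Finsupp.mem_supported F s).1 hs hw)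
  simp only [e]

variable [Fintype F]

variable (F) in
/-- The coefficient `Δ^i_{r,s}`, for positive integers `r, s, i`, with `q` the order of `F`. -/
def deltaCoeff (r s i : ℕ) : F :=
  if (Fintype.card F - 1) ∣ i then
    (-1) ^ (r - 1) * ((i - 1).choose (r - 1) : F) + (-1) ^ (s - 1) * ((i - 1).choose (s - 1) : F)
  else 0

/-- The terms of the diamond product of two words with first letters `x` and `y`, where `m` is the
product `⧢` and `s` stands for the shuffle product of the two remaining words. -/
def diamondTerm (m : WordSpace F →ₗ[F] WordSpace F →ₗ[F] WordSpace F) (x y : Letter F)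
    (s : WordSpace F) : WordSpace F :=
  consLetter (x.1 + y.1, x.2 * y.2) s +
    ∑ p ∈ pairsWithSum (x.1 + y.1),
      deltaCoeff F x.1 y.1 p.2 • consLetter (p.1, x.2 * y.2) (m (word [(p.2, 1)]) s)

/-- The recursion for `𝔞 ⧢ 𝔟`, cut off after `n` nested calls. The calls made for `(𝔞, 𝔟)` have
strictly smaller total depth, so the value is independent of `n` once `n` is at least the total
depth of `𝔞` and `𝔟` (see `shuffleAux_eq`). -/
def shuffleAux : ℕ → Word F → Word F → WordSpace F
  | _, [], v => word v
  | _, x :: u, [] => word (x :: u)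
  | 0, _ :: _, _ :: _ => 0
  | n + 1, x :: u, y :: v =>
      consLetter x (shuffleAux n u (y :: v)) + consLetter y (shuffleAux n (x :: u) v) +
        diamondTerm (bilinExt (shuffleAux n)) x y (shuffleAux n u v)

/-- The shuffle product of two words. -/
def shuffleWord (u v : Word F) : WordSpace F := shuffleAux (u.length + v.length) u v

/-- The shuffle product `⧢` on `𝔇`. -/
def shuffle : WordSpace F →ₗ[F] WordSpace F →ₗ[F] WordSpace F := bilinExt shuffleWord

/-- The diamond product of two words. -/
def diamondWord : Word F → Word F → WordSpace F
  | [], v => word v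
  | x :: u, [] => word (x :: u)
  | x :: u, y :: v => diamondTerm shuffle x y (shuffle (word u) (word v))

/-- The diamond product on `𝔇`. -/
def diamond : WordSpace F →ₗ[F] WordSpace F →ₗ[F] WordSpace F := bilinExt diamondWord

/-! The recursive formulas for the two products. -/

theorem shuffleAux_cons_cons (n : ℕ) (x y : Letter F) (u v : Word F) :
    shuffleAux (n + 1) (x :: u) (y :: v) =
      consLetter x (shuffleAux n u (y :: v)) + consLetter y (shuffleAux n (x :: u) v) +
        diamondTerm (bilinExt (shuffleAux n)) x y (shuffleAux n u v) := rfl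

theorem diamondTerm_congr {f g : Word F → Word F → WordSpace F} (x y : Letter F)
    {s : WordSpace F} {d : ℕ} (hs : s ∈ depthLE F d)
    (h : ∀ (z : Letter F) (w : Word F), w.length ≤ d → f [z] w = g [z] w) :
    diamondTerm (bilinExt f) x y s = diamondTerm (bilinExt g) x y s := by
  have e (j : ℕ+) : bilinExt f (word [(j, 1)]) s = bilinExt g (word [(j, 1)]) s :=
    bilinExt_congr _ hs fun w hw => h _ w hw
  unfold diamondTerm
  simp only [e]

theorem shuffleAux_mem (n : ℕ) (u v : Word F) :
    shuffleAux n u v ∈ depthLE F (u.length + v.length) := by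
  induction n generalizing u v with
  | zero =>
    match u, v with
    | [], v => exact word_mem_depthLE (by simp)
    | x :: u, [] => exact word_mem_depthLE (by simp)
    | x :: u, y :: v => exact Submodule.zero_mem _
  | succ n ih =>
    match u, v with
    | [], v => exact word_mem_depthLE (by simp)
    | x :: u, [] => exact word_mem_depthLE (by simp)
    | x :: u, y :: v =>
      have hs := ih u v
      simp only [shuffleAux, diamondTerm]
      refine Submodule.add_mem _ (Submodule.add_mem _ ?_ ?_) (Submodule.add_mem _ ?_ ?_)
      · exact depthLE_mono (by simp) (consLetter_mem (ih u (y :: v)))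
      · exact depthLE_mono (by simp) (consLetter_mem (ih (x :: u) v))
      · exact depthLE_mono (by simp; lia) (consLetter_mem hs)
      · refine Submodule.sum_mem _ fun p _ => Submodule.smul_mem _ _ ?_
        exact depthLE_mono (by simp; lia) (consLetter_mem (bilinExt_mem ih _ hs))

theorem shuffleAux_succ (n : ℕ) (u v : Word F) (h : u.length + v.length ≤ n) :
    shuffleAux (n + 1) u v = shuffleAux n u v := by
  induction n generalizing u v with
  | zero =>
    match u, v with
    | [], v => rfl
    | x :: u, [] => rfl
    | x :: u, y :: v => simp at h
  | succ n ih =>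
    match u, v with
    | [], v => rfl
    | x :: u, [] => rfl
    | x :: u, y :: v =>
      have hl : u.length + v.length + 1 ≤ n := by
        simp only [List.length_cons] at h
        lia
      have e1 : shuffleAux (n + 1) u (y :: v) = shuffleAux n u (y :: v) :=
        ih _ _ (by simp only [List.length_cons]; lia)
      have e2 : shuffleAux (n + 1) (x :: u) v = shuffleAux n (x :: u) v :=
        ih _ _ (by simp only [List.length_cons]; lia)
      have e3 : shuffleAux (n + 1) u v = shuffleAux n u v := ih _ _ (by lia)
      have e4 := diamondTerm_congr x y (shuffleAux_mem n u v) fun z w hw =>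
        ih [z] w (by simp only [List.length_cons, List.length_nil]; lia)
      rw [shuffleAux_cons_cons (n + 1), shuffleAux_cons_cons n, e1, e2, e3, e4]

theorem shuffleAux_eq (n : ℕ) (u v : Word F) (h : u.length + v.length ≤ n) :
    shuffleAux n u v = shuffleWord u v := by
  induction n, h using Nat.le_induction with
  | base => rfl
  | succ n hn ih => rw [shuffleAux_succ n u v hn, ih]

theorem shuffle_word (u v : Word F) : shuffle (word u) (word v) = shuffleWord u v :=
  bilinExt_word _ _ _

theorem shuffle_nil_left (v : Word F) : shuffle (word []) (word v) = word v := by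
  rw [shuffle_word, ← shuffleAux_eq _ _ _ le_rfl, shuffleAux]

theorem shuffle_nil_right (u : Word F) : shuffle (word u) (word []) = word u := by
  rw [shuffle_word, ← shuffleAux_eq _ _ _ le_rfl]
  cases u <;> rw [shuffleAux]

theorem shuffleWord_cons_cons (x y : Letter F) (u v : Word F) :
    shuffleWord (x :: u) (y :: v) =
      consLetter x (shuffleWord u (y :: v)) + consLetter y (shuffleWord (x :: u) v) +
        diamondTerm shuffle x y (shuffleWord u v) := by
  have e0 := shuffleAux_eq (u.length + v.length + 1 + 1) (x :: u) (y :: v)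
    (by simp only [List.length_cons]; lia)
  have e1 := shuffleAux_eq (u.length + v.length + 1) u (y :: v)
    (by simp only [List.length_cons]; lia)
  have e2 := shuffleAux_eq (u.length + v.length + 1) (x :: u) v
    (by simp only [List.length_cons]; lia)
  have e3 := shuffleAux_eq (u.length + v.length + 1) u v (by lia)
  have hs := shuffleAux_mem (u.length + v.length + 1) u v
  rw [e3] at hs
  have e4 := diamondTerm_congr x y hs fun z w hw =>
    shuffleAux_eq (u.length + v.length + 1) [z] w
      (by simp only [List.length_cons, List.length_nil]; lia)
  rw [← e0, shuffleAux_cons_cons, e1, e2, e3, e4, shuffle]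

theorem shuffle_cons_cons (x y : Letter F) (u v : Word F) :
    shuffle (word (x :: u)) (word (y :: v)) =
      consLetter x (shuffle (word u) (word (y :: v))) +
        consLetter y (shuffle (word (x :: u)) (word v)) +
        diamond (word (x :: u)) (word (y :: v)) := by
  rw [diamond, bilinExt_word, diamondWord]
  simp only [shuffle_word]
  exact shuffleWord_cons_cons x y u v

theorem diamond_cons_cons (x y : Letter F) (u v : Word F) :
    diamond (word (x :: u)) (word (y :: v)) =
      consLetter (x.1 + y.1, x.2 * y.2) (shuffle (word u) (word v)) +
        ∑ p ∈ pairsWithSum (x.1 + y.1),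
          deltaCoeff F x.1 y.1 p.2 • consLetter (p.1, x.2 * y.2)
            (shuffle (word [(p.2, 1)]) (shuffle (word u) (word v))) := by
  rw [diamond, bilinExt_word, diamondWord, diamondTerm]

/-! The coproduct. -/

/-- The triangle product of two words. -/
def triangleWord : Word F → Word F → WordSpace F
  | [], v => word v
  | x :: u, [] => word (x :: u)
  | x :: u, y :: v => consLetter x (shuffle (word u) (word (y :: v)))

/-- The triangle product `▷` on `𝔇`. -/
def triangle : WordSpace F →ₗ[F] WordSpace F →ₗ[F] WordSpace F := bilinExt triangleWord

/-- The bracket `[𝔞]` of a word `𝔞 = x_{i_1} ⋯ x_{i_m}` over `Σ`, where `x_n` is identified with the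
letter `x_{n,1}` of `Γ`. -/
def bracket (a : List ℕ+) : WordSpace F :=
  ((-1) ^ a.length * (a.map fun i => deltaCoeff F 1 ((a.map fun k : ℕ+ => (k : ℕ)).sum + 1) i).prod) •
    a.foldr (fun i s => shuffle (word [(i, 1)]) s) (word [])

/-- The part `∑ a_{n,ε} ⊗ b_{n,ε}` of `Δ(x_{n,ε}) = 1 ⊗ x_{n,ε} + ∑ a_{n,ε} ⊗ b_{n,ε}`. The binomial
coefficient with top entry `-1` occurs only for `r = 1` and `𝔞 = 1`, where its bottom entry is `0`
and its value is `1`, as with truncated subtraction. -/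
def reducedCoproductLetter (x : Letter F) : WordSpace F ⊗[F] WordSpace F :=
  ∑ r ∈ Finset.Icc 1 x.1, ∑ a ∈ sigmaWords ((x.1 : ℕ) - r),
    (((r : ℕ) + a.length - 2).choose a.length : F) • (word [(r, x.2)] ⊗ₜ[F] bracket a)

variable (F) in
/-- The product of two linear maps on `𝔇 ⊗ 𝔇`, given on pure tensors by
`(a ⊗ b, a' ⊗ b') ↦ f a a' ⊗ g b b'`. -/
def tensorProd (f g : WordSpace F →ₗ[F] WordSpace F →ₗ[F] WordSpace F) :
    WordSpace F ⊗[F] WordSpace F →ₗ[F] WordSpace F ⊗[F] WordSpace F →ₗ[F]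
      WordSpace F ⊗[F] WordSpace F :=
  TensorProduct.map₂ f g

/-- The coproduct of a word. -/
def coproductWord : Word F → WordSpace F ⊗[F] WordSpace F
  | [] => word [] ⊗ₜ word []
  | [x] => word [] ⊗ₜ word [x] + reducedCoproductLetter x
  | x :: y :: v => word [] ⊗ₜ word (x :: y :: v) +
      tensorProd F triangle shuffle (reducedCoproductLetter x) (coproductWord (y :: v))

/-- The coproduct `Δ : 𝔇 → 𝔇 ⊗ 𝔇`. -/
def coproduct : WordSpace F →ₗ[F] WordSpace F ⊗[F] WordSpace F :=
  Finsupp.linearCombination F coproductWord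

/-- The shuffle product on `𝔇 ⊗ 𝔇`: `(a ⊗ b) ⧢ (a' ⊗ b') = (a ⧢ a') ⊗ (b ⧢ b')`. -/
def tensorShuffle : WordSpace F ⊗[F] WordSpace F →ₗ[F] WordSpace F ⊗[F] WordSpace F →ₗ[F]
    WordSpace F ⊗[F] WordSpace F :=
  tensorProd F shuffle shuffle

theorem tensorShuffle_tmul (a b a' b' : WordSpace F) :
    tensorShuffle (a ⊗ₜ[F] b) (a' ⊗ₜ[F] b') = shuffle a a' ⊗ₜ[F] shuffle b b' := rfl

end AMZV

end

noncomputable section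

set_option linter.unusedSectionVars false

namespace AMZV

universe u

variable {F : Type u} [Field F] [Fintype F]

/-! Words are turned into functions for which both the shuffle and the coproduct have a meaning. A
system is a list of pairs `(t, j)` whose elements `t` are `F`-independent in an extension field;
each `t` sits above the span `Λ` of the entries after it. The letter `x_{n,ε}` takes at `(t, j)` the
value `ε ^ j * ∑_{v ∈ Λ} (t + v)⁻ⁿ`, and a word takes the sum over all placements of its letters at
strictly decreasing positions.

Evaluation turns the shuffle into multiplication (`zEval_shuffle`). Two letters at different
positions are ordered by position; two letters at the same `t` give a product of two power sums,
which partial fractions rewrite with the sums `∑_{u ∈ Λ} u⁻ᵏ`. Scaling by `Fˣ` shows that such a sum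
is minus the value of `x_k` if `q - 1` divides `k`, and zero otherwise, so the coefficients `Δ` of
the diamond product appear.

Evaluation turns the coproduct into the splitting of a system (`tensorEval_coproduct`). Let `e` be
the additive polynomial with kernel `Λ` and linear coefficient `1`. Then `∑_{u ∈ Λ} 1 / (x + u - z)
= 1 / (e(x) - e(z))`, and expanding in `z` expresses the power sums at `x` through powers of `1 /
e(x)` and the sums `∑ u⁻ᵏ`, with the binomial coefficients in the coproduct of a letter. Hence the
value of a word at `s' ++ s` is the value of its coproduct at the pair `(e(s'), s)`, where `e`
belongs to `s`.

Over an algebraically closed field `e` is surjective, so every pair of systems is of the form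
`(e(s'), s)`. Both sides of the theorem then agree at all pairs, because evaluation at `s' ++ s` is
multiplicative. Evaluations at all pairs separate the elements of the tensor square
(`eq_zero_of_tensorEval_eq_zero`), which finishes the proof. -/

/-! Sums over the `F`-span of a list of elements of a field extension. -/

section LatticeSum

variable {K L M : Type*} [Field K] [Algebra F K] [Field L] [Algebra F L]

variable (F) in
/-- The `F`-span of a list. -/
def latticeSpan : List K → Submodule F K
  | [] => ⊥
  | t :: s => latticeSpan s ⊔ Submodule.span F {t}

variable (F) in
/-- Linear independence over `F` of the elements of a list. -/
def LatticeIndep : List K → Prop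
  | [] => True
  | t :: s => t ∉ latticeSpan F s ∧ LatticeIndep s

variable (F) in
/-- The sum of `f v` over all linear combinations `v` of the elements of a list. -/
def latticeSum [AddCommMonoid M] : List K → (K → M) → M
  | [], f => f 0
  | t :: s, f => ∑ a : F, latticeSum s fun v => f (v + a • t)

theorem mem_latticeSpan_nil {v : K} : v ∈ latticeSpan F ([] : List K) ↔ v = 0 := by
  simp [latticeSpan]

theorem mem_latticeSpan_cons {t v : K} {s : List K} :
    v ∈ latticeSpan F (t :: s) ↔ ∃ w ∈ latticeSpan F s, ∃ a : F, w + a • t = v := by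
  simp [latticeSpan, Submodule.mem_sup, Submodule.mem_span_singleton]

theorem mem_latticeSpan_map (φ : K →ₐ[F] L) {s : List K} {v : L} :
    v ∈ latticeSpan F (s.map φ) ↔ ∃ w ∈ latticeSpan F s, φ w = v := by
  induction s generalizing v with
  | nil => simp [latticeSpan, eq_comm]
  | cons t s ih =>
    simp only [List.map_cons, mem_latticeSpan_cons, ih]
    constructor
    · rintro ⟨_, ⟨w, hw, rfl⟩, a, rfl⟩
      exact ⟨w + a • t, ⟨w, hw, a, rfl⟩, by simp⟩
    · rintro ⟨_, ⟨w, hw, a, rfl⟩, rfl⟩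
      exact ⟨φ w, ⟨w, hw, rfl⟩, a, by simp⟩

theorem map_mem_latticeSpan_map (φ : K →ₐ[F] L) {s : List K} {v : K} :
    φ v ∈ latticeSpan F (s.map φ) ↔ v ∈ latticeSpan F s := by
  rw [mem_latticeSpan_map]
  constructor
  · rintro ⟨w, hw, h⟩
    rwa [← φ.injective h]
  · exact fun h => ⟨v, h, rfl⟩

theorem LatticeIndep.map (φ : K →ₐ[F] L) {s : List K} (h : LatticeIndep F s) :
    LatticeIndep F (s.map φ) := by
  induction s with
  | nil => trivial
  | cons t s ih => exact ⟨fun ht => h.1 ((map_mem_latticeSpan_map φ).1 ht), ih h.2⟩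

theorem add_smul_ne_zero {t : K} {s : List K} (h : t ∉ latticeSpan F s) {v : K}
    (hv : v ∈ latticeSpan F s) {a : F} (ha : a ≠ 0) : v + a • t ≠ 0 := by
  intro h0
  apply h
  have : t = a⁻¹ • (-v) := by
    rw [← eq_neg_of_add_eq_zero_right h0, inv_smul_smul₀ ha]
  rw [this]
  exact Submodule.smul_mem _ _ (Submodule.neg_mem _ hv)

theorem add_ne_zero_of_notMem {t : K} {s : List K} (h : t ∉ latticeSpan F s) {v : K}
    (hv : v ∈ latticeSpan F s) : t + v ≠ 0 := by
  rw [add_comm]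
  simpa using add_smul_ne_zero h hv (one_ne_zero (α := F))

theorem latticeSum_congr [AddCommMonoid M] {s : List K} {f g : K → M}
    (h : ∀ v ∈ latticeSpan F s, f v = g v) : latticeSum F s f = latticeSum F s g := by
  induction s generalizing f g with
  | nil => exact h 0 (Submodule.zero_mem _)
  | cons t s ih =>
    exact Finset.sum_congr rfl fun a _ =>
      ih fun v hv => h _ (mem_latticeSpan_cons.2 ⟨v, hv, a, rfl⟩)

theorem latticeSum_zero [AddCommMonoid M] (s : List K) :
    latticeSum F s (fun _ => (0 : M)) = 0 := by
  induction s with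
  | nil => rfl
  | cons t s ih => simp [latticeSum, ih]

theorem latticeSum_add [AddCommMonoid M] (s : List K) (f g : K → M) :
    latticeSum F s (fun v => f v + g v) = latticeSum F s f + latticeSum F s g := by
  induction s generalizing f g with
  | nil => rfl
  | cons t s ih => simp [latticeSum, ih, Finset.sum_add_distrib]

theorem map_latticeSum {N : Type*} [AddCommMonoid M] [AddCommMonoid N] {G : Type*}
    [FunLike G M N] [AddMonoidHomClass G M N] (φ : G) (s : List K) (f : K → M) :
    φ (latticeSum F s f) = latticeSum F s fun v => φ (f v) := by
  induction s generalizing f with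
  | nil => rfl
  | cons t s ih => simp [latticeSum, ih, map_sum]

theorem latticeSum_sum {ι : Type*} [AddCommMonoid M] (A : Finset ι) (s : List K)
    (f : ι → K → M) :
    latticeSum F s (fun v => ∑ i ∈ A, f i v) = ∑ i ∈ A, latticeSum F s (f i) := by
  induction s generalizing f with
  | nil => rfl
  | cons t s ih =>
    simp only [latticeSum, ih]
    exact Finset.sum_comm

theorem mul_latticeSum (s : List K) (c : L) (f : K → L) :
    c * latticeSum F s f = latticeSum F s fun v => c * f v :=
  map_latticeSum (AddMonoidHom.mulLeft c) s f

theorem latticeSum_mul (s : List K) (c : L) (f : K → L) :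
    latticeSum F s f * c = latticeSum F s fun v => f v * c :=
  map_latticeSum (AddMonoidHom.mulRight c) s f

theorem latticeSum_append [AddCommMonoid M] (s' s : List K) (f : K → M) :
    latticeSum F (s' ++ s) f = latticeSum F s' fun v => latticeSum F s fun u => f (v + u) := by
  induction s' generalizing f with
  | nil => simp [latticeSum]
  | cons t s' ih =>
    simp only [List.cons_append, latticeSum, ih]
    simp only [add_right_comm]

theorem latticeSum_map [AddCommMonoid M] (e : K →ₗ[F] L) (s : List K) (f : L → M) :
    latticeSum F (s.map e) f = latticeSum F s fun v => f (e v) := by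
  induction s generalizing f with
  | nil => simp [latticeSum]
  | cons t s ih => simp [latticeSum, ih]

theorem latticeSum_comm [AddCommMonoid M] (s : List K) (s' : List L) (f : K → L → M) :
    latticeSum F s (fun v => latticeSum F s' (f v)) =
      latticeSum F s' fun w => latticeSum F s fun v => f v w := by
  induction s generalizing f with
  | nil => rfl
  | cons t s ih => simp only [latticeSum, ih, latticeSum_sum]

/-- Substituting `v - u` for the inner variable of a double sum. -/
theorem latticeSum_latticeSum_sub [AddCommMonoid M] (s : List K) (h : K → K → M) :
    latticeSum F s (fun v => latticeSum F s (h v)) =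
      latticeSum F s fun v => latticeSum F s fun u => h v (v - u) := by
  induction s generalizing h with
  | nil => simp [latticeSum]
  | cons t s ih =>
    simp only [latticeSum, latticeSum_sum]
    refine Finset.sum_congr rfl fun a _ => ?_
    rw [← (Equiv.subLeft a).sum_comp]
    refine Finset.sum_congr rfl fun b _ => ?_
    rw [ih]
    simp only [Equiv.subLeft_apply]
    refine latticeSum_congr fun v _ => latticeSum_congr fun u _ => ?_
    rw [sub_smul]
    congr 1
    abel

-- Independence makes the combination with all coefficients zero the only one with value zero, so
-- exactly one term survives.
open Classical in
theorem latticeSum_ite_eq_zero [AddCommMonoid M] {s : List K} (hs : LatticeIndep F s)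
    (f : K → M) : latticeSum F s (fun v => if v = 0 then f v else 0) = f 0 := by
  induction s generalizing f with
  | nil => simp [latticeSum]
  | cons t s ih =>
    rw [latticeSum, Finset.sum_eq_single 0]
    · simpa using ih hs.2 f
    · intro a _ ha
      refine Eq.trans ?_ (latticeSum_zero (F := F) s)
      exact latticeSum_congr fun v hv => if_neg (add_smul_ne_zero hs.1 hv ha)
    · simp

end LatticeSum

/-! Partial fractions and power sums. -/

/-- The partial fraction expansion of `1 / (x ^ (a + 1) * y ^ (b + 1))`, with `X = 1 / x`,
`Y = 1 / y` and `U = 1 / (x - y)`. -/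
theorem partial_fraction {R : Type*} [CommRing R] {X Y U : R} (h : X * Y = U * (Y - X)) (a b : ℕ) :
    X ^ (a + 1) * Y ^ (b + 1) = ∑ k ∈ Finset.range (a + b + 1), U ^ (k + 1) *
      ((-1) ^ (k + a) * (k.choose a : R) * Y ^ (a + b + 1 - k) +
        (-1) ^ (b + 1) * (k.choose b : R) * X ^ (a + b + 1 - k)) := by
  induction a generalizing b with
  | zero =>
    induction b with
    | zero => simpa [sub_eq_add_neg] using h
    | succ b ih =>
      -- Here and in the other inductive cases, `h` trades one factor `X * Y` for `U` times a
      -- difference, which lowers the total degree by one. Pascal's rule then combines the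
      -- coefficients.
      have e : X ^ (0 + 1) * Y ^ (b + 1 + 1) =
          U * Y ^ (b + 2) - U * (X ^ (0 + 1) * Y ^ (b + 1)) := by
        linear_combination Y ^ (b + 1) * h
      rw [e, ih, Finset.sum_range_succ' _ (0 + (b + 1)), Finset.mul_sum, sub_eq_neg_add,
        ← Finset.sum_neg_distrib]
      congr 1
      · rw [← add_assoc]
        refine Finset.sum_congr rfl fun k hk => ?_
        have hk' : k < b + 1 := by simpa using hk
        rw [Nat.choose_succ_succ' k b, Nat.choose_eq_zero_of_lt hk',
          show 0 + b + 1 + 1 - (k + 1) = 0 + b + 1 - k by lia]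
        simp only [Nat.choose_zero_right]
        push_cast
        ring
      · simp
  | succ a iha =>
    induction b with
    | zero =>
      have e : X ^ (a + 1 + 1) * Y ^ (0 + 1) =
          U * (X ^ (a + 1) * Y ^ (0 + 1)) - U * X ^ (a + 2) := by
        linear_combination X ^ (a + 1) * h
      rw [e, iha, Finset.sum_range_succ' _ (a + 1 + 0), Finset.mul_sum, sub_eq_add_neg]
      congr 1
      · rw [add_right_comm a 1 0]
        refine Finset.sum_congr rfl fun k hk => ?_
        have hk' : k < a + 1 := by simpa using hk
        rw [Nat.choose_succ_succ' k a, Nat.choose_eq_zero_of_lt hk',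
          show a + 0 + 1 + 1 - (k + 1) = a + 0 + 1 - k by lia]
        simp only [Nat.choose_zero_right]
        push_cast
        ring
      · simp
    | succ b ihb =>
      have e : X ^ (a + 1 + 1) * Y ^ (b + 1 + 1) = U * (X ^ (a + 1) * Y ^ (b + 1 + 1)) -
          U * (X ^ (a + 1 + 1) * Y ^ (b + 1)) := by
        linear_combination X ^ (a + 1) * Y ^ (b + 1) * h
      rw [e, iha, ihb, Finset.sum_range_succ' _ (a + 1 + (b + 1)), ← mul_sub,
        show a + 1 + b + 1 = a + (b + 1) + 1 by lia, show a + 1 + (b + 1) = a + (b + 1) + 1 by lia,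
        ← Finset.sum_sub_distrib, Finset.mul_sum]
      simp only [Nat.choose_zero_succ, Nat.cast_zero, mul_zero, zero_mul, add_zero]
      refine Finset.sum_congr rfl fun k _ => ?_
      rw [Nat.choose_succ_succ' k a, Nat.choose_succ_succ' k b,
        show a + (b + 1) + 1 + 1 - (k + 1) = a + (b + 1) + 1 - k by lia]
      push_cast
      ring

section PowSum

variable {K L : Type*} [Field K] [Algebra F K] [Field L] [Algebra F L]

variable (F) in
/-- The power sum `∑ 1 / (t + v) ^ n` over the lattice spanned by `s`. -/
def powSum (s : List K) (t : K) (n : ℕ) : K :=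
  latticeSum F s fun v => ((t + v)⁻¹) ^ n

theorem map_powSum (φ : K →ₐ[F] L) (s : List K) (t : K) (n : ℕ) :
    powSum F (s.map φ) (φ t) n = φ (powSum F s t n) := by
  rw [powSum, powSum, map_latticeSum]
  refine (latticeSum_map φ.toLinearMap s _).trans ?_
  simp

theorem latticeSum_smul {M : Type*} [AddCommMonoid M] {a : F} (ha : a ≠ 0) (s : List K)
    (f : K → M) : latticeSum F s (fun v => f (a • v)) = latticeSum F s f := by
  induction s generalizing f with
  | nil => simp [latticeSum]
  | cons t s ih =>
    refine Eq.trans ?_ (Equiv.sum_comp (Equiv.mulLeft₀ a ha) _)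
    refine Finset.sum_congr rfl fun b _ => ?_
    rw [← ih fun v => f (v + _ • t)]
    simp [smul_smul]

theorem latticeSum_neg {M : Type*} [AddCommMonoid M] (s : List K)
    (f : K → M) : latticeSum F s (fun v => f (-v)) = latticeSum F s f := by
  simpa using latticeSum_smul (neg_ne_zero.2 (one_ne_zero (α := F))) s f

theorem sum_pow_of_ne_zero {n : ℕ} (hn : n ≠ 0) :
    ∑ a : F, a ^ n = if (Fintype.card F - 1) ∣ n then -1 else 0 := by
  classical
  rw [← FiniteField.sum_pow_units]
  refine (Fintype.sum_of_injective _ Units.val_injective _ _ (fun a ha => ?_) fun _ => rfl).symm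
  have h0 : a = 0 := by
    by_contra h
    exact ha ⟨Units.mk0 a h, rfl⟩
  rw [h0, zero_pow hn]

theorem sum_inv_pow_of_ne_zero {n : ℕ} (hn : n ≠ 0) :
    ∑ a : F, a⁻¹ ^ n = if (Fintype.card F - 1) ∣ n then -1 else 0 := by
  rw [← sum_pow_of_ne_zero hn]
  exact Equiv.sum_comp (Equiv.inv F) fun a : F => a ^ n

/-- A term `v + a • t` with `a ≠ 0` can be rescaled by `a`, which pulls out `a⁻ⁿ`; summing this over
`a` gives `-1` or `0`. This is the source of the divisibility condition in `deltaCoeff`. -/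
theorem latticeSum_inv_pow_cons (s : List K) (t : K) {n : ℕ} (hn : n ≠ 0) :
    latticeSum F (t :: s) (fun v => v⁻¹ ^ n) = latticeSum F s (fun v => v⁻¹ ^ n) -
      if (Fintype.card F - 1) ∣ n then powSum F s t n else 0 := by
  classical
  have h (a : F) : latticeSum F s (fun v => (v + a • t)⁻¹ ^ n) =
      (if a = 0 then latticeSum F s (fun v => v⁻¹ ^ n) else 0) +
        algebraMap F K (a⁻¹ ^ n) * powSum F s t n := by
    by_cases ha : a = 0
    · simp [ha, hn]
    · rw [if_neg ha, zero_add, ← latticeSum_smul ha, powSum, mul_latticeSum]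
      congr! 2 with v
      rw [← smul_add, add_comm t, Algebra.smul_def, mul_inv, mul_pow, map_pow, map_inv₀]
  rw [latticeSum, Finset.sum_congr rfl fun a _ => h a, Finset.sum_add_distrib, ← Finset.sum_mul,
    ← map_sum, sum_inv_pow_of_ne_zero hn]
  split_ifs <;> simp [sub_eq_add_neg]

/-- In the double sum over two lattice vectors, the diagonal gives the power sum of exponent `a + b
+ 2`. Off the diagonal, partial fractions separate the difference `u` of the two vectors from one of
the two factors. -/
theorem powSum_mul_powSum {s : List K} (hs : LatticeIndep F s) {t : K} (ht : t ∉ latticeSpan F s)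
    (a b : ℕ) :
    powSum F s t (a + 1) * powSum F s t (b + 1) = powSum F s t (a + b + 2) -
      ∑ k ∈ Finset.range (a + b + 1), ((-1) ^ a * (k.choose a : K) + (-1) ^ b * (k.choose b : K)) *
        (powSum F s t (a + b + 1 - k) * latticeSum F s fun u => u⁻¹ ^ (k + 1)) := by
  classical
  -- `partial_fraction` is used with `x = t + v` and `y = t + (v - u)`, so that `x - y = u`. For `u
  -- = 0` the sum over `k` vanishes, since `0⁻¹ = 0`.
  have key : ∀ v ∈ latticeSpan F s, ∀ u ∈ latticeSpan F s,
      (t + v)⁻¹ ^ (a + 1) * (t + (v - u))⁻¹ ^ (b + 1) =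
        (if u = 0 then (t + (v - u))⁻¹ ^ (a + b + 2) else 0) +
          ∑ k ∈ Finset.range (a + b + 1), u⁻¹ ^ (k + 1) *
            ((-1) ^ (k + a) * (k.choose a : K) * (t + (v - u))⁻¹ ^ (a + b + 1 - k) +
              (-1) ^ (b + 1) * (k.choose b : K) * (t + v)⁻¹ ^ (a + b + 1 - k)) := by
    intro v hv u hu
    by_cases h0 : u = 0
    · simp only [h0, if_true, sub_zero, inv_zero, ne_eq, Nat.succ_ne_zero, not_false_eq_true,
        zero_pow, zero_mul, Finset.sum_const_zero, add_zero]
      ring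
    · rw [if_neg h0, zero_add]
      refine partial_fraction ?_ a b
      have h1 := add_ne_zero_of_notMem ht hv
      have h2 := add_ne_zero_of_notMem ht (Submodule.sub_mem _ hv hu)
      field_simp
      ring
  have hX (i j : ℕ) : latticeSum F s (fun v => latticeSum F s fun u =>
      u⁻¹ ^ j * (t + v)⁻¹ ^ i) = powSum F s t i * latticeSum F s fun u => u⁻¹ ^ j := by
    rw [powSum, latticeSum_mul]
    congr! 2 with v
    rw [mul_comm, latticeSum_mul]
  have hY (i j : ℕ) : latticeSum F s (fun v => latticeSum F s fun u =>
      u⁻¹ ^ j * (t + (v - u))⁻¹ ^ i) =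
        (-1) ^ j * (powSum F s t i * latticeSum F s fun u => u⁻¹ ^ j) := by
    have e := latticeSum_latticeSum_sub (F := F) s fun v w : K =>
      (v - w)⁻¹ ^ j * (t + w)⁻¹ ^ i
    simp only [sub_sub_cancel] at e
    rw [← e, latticeSum_comm, latticeSum_latticeSum_sub, ← hX, mul_latticeSum]
    congr! 2 with w
    rw [mul_latticeSum]
    congr! 2 with u
    rw [sub_sub_cancel_left, inv_neg, neg_pow, mul_assoc]
  have hD : latticeSum F s (fun v => latticeSum F s fun u =>
      if u = 0 then (t + (v - u))⁻¹ ^ (a + b + 2) else 0) = powSum F s t (a + b + 2) := by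
    rw [powSum]
    congr! 2 with v
    simpa using latticeSum_ite_eq_zero hs fun u => (t + (v - u))⁻¹ ^ (a + b + 2)
  have e : powSum F s t (a + 1) * powSum F s t (b + 1) = latticeSum F s fun v =>
      latticeSum F s fun w => (t + v)⁻¹ ^ (a + 1) * (t + w)⁻¹ ^ (b + 1) := by
    simp only [powSum, latticeSum_mul, mul_latticeSum]
    exact latticeSum_comm ..
  rw [e, latticeSum_latticeSum_sub, latticeSum_congr fun v hv => latticeSum_congr (key v hv)]
  simp only [latticeSum_add, latticeSum_sum, hD]
  rw [sub_eq_add_neg, ← Finset.sum_neg_distrib]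
  congr 1
  refine Finset.sum_congr rfl fun k _ => ?_
  simp only [mul_add, latticeSum_add, mul_left_comm _ (_ * _ : K) (_ ^ (_ - _)), ← mul_latticeSum,
    hX, hY]
  have hk : ((-1 : K) ^ k) ^ 2 = 1 := by rw [← pow_mul, mul_comm, pow_mul, neg_one_sq, one_pow]
  generalize powSum F s t (a + b + 1 - k) * latticeSum F s (fun u => u⁻¹ ^ (k + 1)) = P
  linear_combination -(-1) ^ a * (k.choose a : K) * P * hk

theorem sum_pairsWithSum {M : Type*} [AddCommMonoid M] (n : ℕ+) (f : ℕ → ℕ → M) :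
    ∑ p ∈ pairsWithSum n, f p.1 p.2 =
      ∑ k ∈ Finset.range ((n : ℕ) - 1), f ((n : ℕ) - 1 - k) (k + 1) := by
  refine Finset.sum_bij' (fun p _ => (p.2 : ℕ) - 1)
    (fun k _ => (((n : ℕ) - 1 - k).toPNat', (k + 1).toPNat')) ?_ ?_ ?_ ?_ ?_
  · rintro ⟨i, j⟩ h
    rw [mem_pairsWithSum] at h
    subst h
    have := i.pos
    have := j.pos
    simp
    lia
  · intro k hk
    rw [Finset.mem_range] at hk
    rw [mem_pairsWithSum, ← PNat.coe_inj]
    simp [Nat.toPNat'_coe]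
    split_ifs <;> lia
  · rintro ⟨i, j⟩ h
    rw [mem_pairsWithSum] at h
    subst h
    have := i.pos
    have := j.pos
    simp [← PNat.coe_inj, Nat.toPNat'_coe]
    lia
  · intro k hk
    simp
  · rintro ⟨i, j⟩ h
    rw [mem_pairsWithSum] at h
    subst h
    have := i.pos
    have := j.pos
    simp
    congr 1 <;> lia

end PowSum

/-! Evaluation of words at a list of pairs `(t, j)`, where `t` spans a new line of the lattice and
`ε ↦ ε ^ j` is the character attached to it. -/

section Evaluation

variable {K L : Type*} [Field K] [Algebra F K] [Field L] [Algebra F L]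

/-- The value of the letter `x` at the pair `(t, j)` added to the system `s`. -/
def letterValue (s : List (K × ℕ)) (t : K) (j : ℕ) (x : Letter F) : K :=
  algebraMap F K ((x.2 : F) ^ j) * powSum F (s.map Prod.fst) t x.1

/-- The values of the words whose first letter is evaluated at the pair `(t, j)`. -/
def levelWord (s : List (K × ℕ)) (t : K) (j : ℕ) (f : Word F → K) : Word F → K
  | [] => 0
  | x :: u => letterValue s t j x * f u

/-- The value of a word at a system: the sum over strictly decreasing positions of the products of
the values of its letters. -/
def zWord : List (K × ℕ) → Word F → K
  | [], [] => 1
  | [], _ :: _ => 0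
  | (t, j) :: s, w => zWord s w + levelWord s t j (zWord s) w

variable (F) in
/-- The linear extension of `zWord`. -/
def zEval (s : List (K × ℕ)) : WordSpace F →ₗ[F] K := Finsupp.linearCombination F (zWord s)

variable (F) in
/-- The linear extension of `levelWord`. -/
def levelEval (s : List (K × ℕ)) (t : K) (j : ℕ) : WordSpace F →ₗ[F] K :=
  Finsupp.linearCombination F (levelWord s t j (zWord s))

theorem wordSpace_hom_ext {M : Type*} [AddCommMonoid M] [Module F M] {f g : WordSpace F →ₗ[F] M}
    (h : ∀ w, f (word w) = g (word w)) : f = g :=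
  Finsupp.lhom_ext' fun w => LinearMap.ext_ring (h w)

theorem consLetter_word (x : Letter F) (u : Word F) : consLetter x (word u) = word (x :: u) := by
  simp [consLetter, word]

@[simp] theorem zEval_word (s : List (K × ℕ)) (w : Word F) : zEval F s (word w) = zWord s w := by
  simp [zEval, word]

@[simp] theorem levelEval_word (s : List (K × ℕ)) (t : K) (j : ℕ) (w : Word F) :
    levelEval F s t j (word w) = levelWord s t j (zWord s) w := by
  simp [levelEval, word]

theorem zEval_cons (s : List (K × ℕ)) (t : K) (j : ℕ) :
    zEval F ((t, j) :: s) = zEval F s + levelEval F s t j :=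
  wordSpace_hom_ext fun w => by simp [zWord]

theorem levelEval_consLetter (s : List (K × ℕ)) (t : K) (j : ℕ) (x : Letter F)
    (a : WordSpace F) :
    levelEval F s t j (consLetter x a) = letterValue s t j x * zEval F s a := by
  have h : levelEval F s t j ∘ₗ consLetter x =
      LinearMap.mulLeft F (letterValue s t j x) ∘ₗ zEval F s :=
    wordSpace_hom_ext fun w => by simp [consLetter_word, levelWord]
  exact LinearMap.congr_fun h a

theorem zEval_nil_consLetter (x : Letter F) (a : WordSpace F) :
    zEval F ([] : List (K × ℕ)) (consLetter x a) = 0 :=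
  LinearMap.congr_fun (f := zEval F ([] : List (K × ℕ)) ∘ₗ consLetter x) (g := 0)
    (wordSpace_hom_ext fun w => by simp [consLetter_word, zWord]) a

theorem zWord_nil (s : List (K × ℕ)) : zWord s ([] : Word F) = 1 := by
  induction s with
  | nil => rfl
  | cons p s ih => simp [zWord, levelWord, ih]

theorem map_letterValue (φ : K →ₐ[F] L) (s : List (K × ℕ)) (t : K) (j : ℕ) (x : Letter F) :
    letterValue (s.map (Prod.map φ id)) (φ t) j x = φ (letterValue s t j x) := by
  rw [letterValue, letterValue, map_mul, ← map_powSum, AlgHom.commutes]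
  simp [Function.comp_def]

theorem map_zWord (φ : K →ₐ[F] L) (s : List (K × ℕ)) (w : Word F) :
    zWord (s.map (Prod.map φ id)) w = φ (zWord s w) := by
  induction s generalizing w with
  | nil => cases w <;> simp [zWord]
  | cons p s ih =>
    obtain ⟨t, j⟩ := p
    simp only [List.map_cons, Prod.map_apply, id, zWord, ih, map_add]
    cases w <;> simp [levelWord, map_letterValue, ih]

/-- Adding the entries of the system one at a time builds up the depth-one value of `x_n`. The
characters play no role, as the letter has `ε = 1`. -/
theorem latticeSum_inv_pow (s : List (K × ℕ)) (n : ℕ+) :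
    latticeSum F (s.map Prod.fst) (fun v => v⁻¹ ^ (n : ℕ)) =
      if (Fintype.card F - 1) ∣ (n : ℕ) then -zWord s [((n, 1) : Letter F)] else 0 := by
  induction s with
  | nil => simp [latticeSum, zWord]
  | cons p s ih =>
    obtain ⟨t, j⟩ := p
    rw [List.map_cons, latticeSum_inv_pow_cons _ _ n.ne_zero, ih]
    split_ifs
    · simp [zWord, levelWord, letterValue, zWord_nil]
      ring
    · simp

theorem letterValue_mul_letterValue {s : List (K × ℕ)} {t : K}
    (h : LatticeIndep F (t :: s.map Prod.fst)) (j : ℕ) (x y : Letter F) :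
    letterValue s t j x * letterValue s t j y = letterValue s t j (x.1 + y.1, x.2 * y.2) +
      ∑ p ∈ pairsWithSum (x.1 + y.1), deltaCoeff F x.1 y.1 p.2 •
        (letterValue s t j (p.1, x.2 * y.2) * zWord s [((p.2, 1) : Letter F)]) := by
  obtain ⟨a, ha⟩ := Nat.exists_eq_succ_of_ne_zero x.1.ne_zero
  obtain ⟨b, hb⟩ := Nat.exists_eq_succ_of_ne_zero y.1.ne_zero
  have hn : ((x.1 + y.1 : ℕ+) : ℕ) = a + b + 2 := by
    rw [PNat.add_coe]
    lia
  have e := sum_pairsWithSum (x.1 + y.1) fun i k =>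
    (((-1) ^ a * ((k - 1).choose a : K) + (-1) ^ b * ((k - 1).choose b : K)) *
        (powSum F (s.map Prod.fst) t i *
          latticeSum F (s.map Prod.fst) fun u => u⁻¹ ^ k))
  have e' := powSum_mul_powSum h.2 h.1 a b
  simp only [hn, Nat.add_sub_cancel, show a + b + 2 - 1 = a + b + 1 by lia] at e
  rw [sub_eq_add_neg, ← e] at e'
  simp only [letterValue, ha, hb, hn]
  rw [mul_mul_mul_comm, e', mul_add, ← map_mul, ← mul_pow, ← Finset.sum_neg_distrib,
    Finset.mul_sum, Units.val_mul]
  congr 1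
  refine Finset.sum_congr rfl fun p _ => ?_
  rw [latticeSum_inv_pow, Algebra.smul_def, deltaCoeff]
  split_ifs
  · simp
    ring
  · simp

/-- The diamond product records the case of both first letters placed at the same position. -/
theorem levelEval_diamond_cons_cons {s : List (K × ℕ)} {t : K}
    (h : LatticeIndep F (t :: s.map Prod.fst)) (j : ℕ)
    (hs : ∀ a b : WordSpace F, zEval F s (shuffle a b) = zEval F s a * zEval F s b)
    (x y : Letter F) (u v : Word F) :
    levelEval F s t j (diamond (word (x :: u)) (word (y :: v))) =
      levelEval F s t j (word (x :: u)) * levelEval F s t j (word (y :: v)) := by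
  rw [diamond_cons_cons, map_add, map_sum, levelEval_consLetter, hs]
  simp only [map_smul, levelEval_consLetter, hs, zEval_word, levelEval_word, levelWord]
  rw [mul_mul_mul_comm, letterValue_mul_letterValue h, add_mul, Finset.sum_mul]
  congr 1
  refine Finset.sum_congr rfl fun p _ => ?_
  rw [smul_mul_assoc, mul_assoc]

theorem map_mul_of_word {R : Type*} [CommRing R] [Algebra F R]
    {m : WordSpace F →ₗ[F] WordSpace F →ₗ[F] WordSpace F} {φ : WordSpace F →ₗ[F] R}
    (h : ∀ u v, φ (m (word u) (word v)) = φ (word u) * φ (word v)) (a b : WordSpace F) :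
    φ (m a b) = φ a * φ b := by
  have e : m.compr₂ φ = (LinearMap.mul F R).compl₁₂ φ φ :=
    wordSpace_hom_ext fun u => wordSpace_hom_ext fun v => by simpa using h u v
  simpa using LinearMap.congr_fun₂ e a b

/-- The evaluation at an independent system is multiplicative for the shuffle product. -/
theorem zEval_shuffle {s : List (K × ℕ)} (h : LatticeIndep F (s.map Prod.fst))
    (a b : WordSpace F) : zEval F s (shuffle a b) = zEval F s a * zEval F s b := by
  induction s generalizing a b with
  | nil =>
    refine map_mul_of_word (fun u v => ?_) a b
    match u, v with
    | [], v => simp [shuffle_nil_left, zWord]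
    | x :: u, [] => simp [shuffle_nil_right, zWord]
    | x :: u, y :: v =>
      rw [shuffle_cons_cons, diamond_cons_cons]
      simp [zEval_nil_consLetter, zWord]
  | cons p s ih =>
    obtain ⟨t, j⟩ := p
    have ih' := ih h.2
    refine map_mul_of_word (fun u v => ?_) a b
    match u, v with
    | [], v => simp [shuffle_nil_left, zWord_nil]
    | x :: u, [] => simp [shuffle_nil_right, zWord_nil]
    | x :: u, y :: v =>
      -- Three cases for the top position: it carries the first letter of the left word only, of the
      -- right word only, or of both.
      have e : levelEval F s t j (shuffle (word (x :: u)) (word (y :: v))) =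
          levelEval F s t j (word (x :: u)) * zEval F s (word (y :: v)) +
            levelEval F s t j (word (y :: v)) * zEval F s (word (x :: u)) +
            levelEval F s t j (word (x :: u)) * levelEval F s t j (word (y :: v)) := by
        rw [shuffle_cons_cons, map_add, map_add, levelEval_diamond_cons_cons h j ih',
          levelEval_consLetter, levelEval_consLetter, ih', ih', levelEval_word, levelEval_word]
        simp only [levelWord, zEval_word]
        ring
      rw [zEval_cons, LinearMap.add_apply, LinearMap.add_apply, LinearMap.add_apply, ih', e]
      ring

end Evaluation

/-! The additive polynomial whose roots are the lattice. -/

section Exponential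

variable {K L : Type*} [Field K] [Algebra F K] [Field L] [Algebra F L]

variable (F) in
/-- The additive polynomial function with kernel the span of the list and linear coefficient `1`. -/
def expMap : List K → K →ₗ[F] K
  | [] => LinearMap.id
  | t :: s => expMap s - LinearMap.mulLeft F ((expMap s t)⁻¹ ^ (Fintype.card F - 1)) ∘ₗ
      (FiniteField.frobeniusAlgHom F K).toLinearMap ∘ₗ expMap s

theorem expMap_cons_apply (t : K) (s : List K) (y : K) :
    expMap F (t :: s) y = expMap F s y -
      (expMap F s t)⁻¹ ^ (Fintype.card F - 1) * expMap F s y ^ Fintype.card F := by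
  simp [expMap]

theorem expMap_map (φ : K →ₐ[F] L) (s : List K) (y : K) :
    expMap F (s.map φ) (φ y) = φ (expMap F s y) := by
  induction s generalizing y with
  | nil => rfl
  | cons t s ih => simp [List.map_cons, expMap_cons_apply, ih]

variable (F) in
theorem prod_X_sub_C_finite_field :
    ∏ a : F, (Polynomial.X - Polynomial.C a) = Polynomial.X ^ Fintype.card F - Polynomial.X := by
  have h := FiniteField.roots_X_pow_card_sub_X F
  have hd := FiniteField.X_pow_card_sub_X_natDegree_eq F (Fintype.one_lt_card (α := F))
  have hm : (Polynomial.X ^ Fintype.card F - Polynomial.X : Polynomial F).Monic :=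
    Polynomial.monic_X_pow_sub (by simpa using Fintype.one_lt_card (α := F))
  rw [← Polynomial.prod_multiset_X_sub_C_of_monic_of_roots_card_eq hm (by rw [h, hd]; rfl), h]
  rfl

theorem prod_sub_algebraMap (y : K) :
    ∏ a : F, (y - algebraMap F K a) = y ^ Fintype.card F - y := by
  simpa [Polynomial.aeval_prod] using
    congrArg (Polynomial.aeval y) (prod_X_sub_C_finite_field F)

/-- Logarithmic derivative of `X ^ q - X = ∏ (X - a)`, whose derivative is the constant `-1`. -/
theorem sum_inv_sub_algebraMap {y : K} (h : ∀ a : F, y - algebraMap F K a ≠ 0) :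
    ∑ a : F, (y - algebraMap F K a)⁻¹ = (y - y ^ Fintype.card F)⁻¹ := by
  classical
  have e := congrArg (fun p => Polynomial.aeval y (Polynomial.derivative p))
    (prod_X_sub_C_finite_field F)
  simp only [Polynomial.derivative_prod_finset, map_sum,
    Polynomial.derivative_X, Polynomial.derivative_C, sub_zero, mul_one, map_prod, map_sub,
    Polynomial.aeval_X, Polynomial.aeval_C, Polynomial.derivative_X_pow,
    FiniteField.cast_card_eq_zero, map_zero, zero_mul, zero_sub, map_neg, map_one] at e
  have hP : y ^ Fintype.card F - y ≠ 0 := by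
    rw [← prod_sub_algebraMap (F := F)]
    exact Finset.prod_ne_zero_iff.2 fun a _ => h a
  rw [← neg_sub, inv_neg, eq_neg_iff_add_eq_zero, ← mul_right_inj' hP, mul_add, mul_inv_cancel₀ hP,
    mul_zero, Finset.mul_sum, ← eq_neg_iff_add_eq_zero, ← e]
  refine Finset.sum_congr rfl fun a _ => ?_
  rw [← prod_sub_algebraMap (F := F), ← Finset.mul_prod_erase _ _ (Finset.mem_univ a)]
  field_simp [h a]

theorem sum_inv_add_smul {c y : K} (hc : c ≠ 0) (h : ∀ a : F, y + a • c ≠ 0) :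
    ∑ a : F, (y + a • c)⁻¹ = (y - c⁻¹ ^ (Fintype.card F - 1) * y ^ Fintype.card F)⁻¹ := by
  have e (a : F) : y + a • c = (y / c - algebraMap F K (-a)) * c := by
    rw [Algebra.smul_def, map_neg]
    field_simp
    ring
  have h' (a : F) : y / c - algebraMap F K a ≠ 0 := fun h0 => h (-a) <| by
    rw [e, neg_neg, h0, zero_mul]
  have e' : y - c⁻¹ ^ (Fintype.card F - 1) * y ^ Fintype.card F =
      (y / c - (y / c) ^ Fintype.card F) * c := by
    obtain ⟨q, hq⟩ := Nat.exists_eq_succ_of_ne_zero (Fintype.card_ne_zero (α := F))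
    rw [hq, Nat.succ_sub_one, pow_succ _ q, pow_succ _ q, div_pow, inv_pow]
    field_simp
  simp only [e, mul_inv]
  rw [← Finset.sum_mul, e', mul_inv, ← sum_inv_sub_algebraMap h']
  congr 1
  exact Equiv.sum_comp (Equiv.neg F) fun a => (y / c - algebraMap F K a)⁻¹

/-- The recursive step vanishes at `x` exactly when the ratio of `expMap F s x` to `expMap F s t` is
a root of `Y ^ q - Y`, that is, lies in `F`. -/
theorem expMap_eq_zero_iff {s : List K} (hs : LatticeIndep F s) {x : K} :
    expMap F s x = 0 ↔ x ∈ latticeSpan F s := by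
  induction s generalizing x with
  | nil => simp [expMap, latticeSpan]
  | cons t s ih =>
    have ht : expMap F s t ≠ 0 := fun h => hs.1 ((ih hs.2).1 h)
    rw [expMap_cons_apply, mem_latticeSpan_cons]
    constructor
    · intro h
      have h' : ∏ a : F, (expMap F s x / expMap F s t - algebraMap F K a) = 0 := by
        rw [prod_sub_algebraMap, ← neg_sub, neg_eq_zero, ← mul_left_inj' ht, zero_mul, ← h, sub_mul,
          div_mul_cancel₀ _ ht]
        obtain ⟨q, hq⟩ := Nat.exists_eq_succ_of_ne_zero (Fintype.card_ne_zero (α := F))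
        rw [hq, Nat.succ_sub_one, pow_succ _ q, pow_succ _ q, div_pow, inv_pow]
        field_simp
      obtain ⟨a, -, ha⟩ := Finset.prod_eq_zero_iff.1 h'
      refine ⟨x - a • t, (ih hs.2).1 ?_, a, by simp⟩
      rw [sub_eq_zero, div_eq_iff ht] at ha
      rw [map_sub, map_smul, ha, Algebra.smul_def, sub_self]
    · rintro ⟨w, hw, a, rfl⟩
      rw [map_add, (ih hs.2).2 hw, zero_add, map_smul, Algebra.smul_def, mul_pow, ← map_pow,
        FiniteField.pow_card]
      obtain ⟨q, hq⟩ := Nat.exists_eq_succ_of_ne_zero (Fintype.card_ne_zero (α := F))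
      rw [hq, Nat.succ_sub_one, pow_succ _ q]
      have := inv_mul_cancel₀ (pow_ne_zero q ht)
      rw [inv_pow]
      linear_combination -(algebraMap F K a * expMap F s t) * this

/-- The logarithmic derivative of `expMap`. -/
theorem latticeSum_inv_add {s : List K} (hs : LatticeIndep F s) {x : K}
    (hx : x ∉ latticeSpan F s) :
    latticeSum F s (fun u => (x + u)⁻¹) = (expMap F s x)⁻¹ := by
  induction s generalizing x with
  | nil => simp [latticeSum, expMap]
  | cons t s ih =>
    have hx' (a : F) : x + a • t ∉ latticeSpan F s := fun h =>
      hx (mem_latticeSpan_cons.2 ⟨_, h, -a, by simp⟩)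
    have e (a : F) : latticeSum F s (fun u => (x + (u + a • t))⁻¹) =
        (expMap F s x + a • expMap F s t)⁻¹ := by
      rw [← map_smul, ← map_add, ← ih hs.2 (hx' a)]
      congr! 2 with u
      abel_nf
    rw [latticeSum, expMap_cons_apply, Finset.sum_congr rfl fun a _ => e a]
    refine sum_inv_add_smul (fun h => hs.1 ((expMap_eq_zero_iff hs.2).1 h)) fun a h => ?_
    rw [← map_smul, ← map_add] at h
    exact hx' a ((expMap_eq_zero_iff hs.2).1 h)

/-- Each recursive step asks for a root of `c * w ^ q - w + y`, followed by a preimage of `w`. This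
allows arbitrary systems to be lifted through `expMap`. -/
theorem expMap_surjective [IsAlgClosed K] {s : List K} (hs : LatticeIndep F s) :
    Function.Surjective (expMap F s) := by
  induction s with
  | nil => exact Function.surjective_id
  | cons t s ih =>
    intro y
    have ht : expMap F s t ≠ 0 := fun h => hs.1 ((expMap_eq_zero_iff hs.2).1 h)
    set c := (expMap F s t)⁻¹ ^ (Fintype.card F - 1) with hc
    have hc0 : c ≠ 0 := pow_ne_zero _ (inv_ne_zero ht)
    have hq := Fintype.one_lt_card (α := F)
    let p : Polynomial K := Polynomial.C c * Polynomial.X ^ Fintype.card F -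
      (Polynomial.X - Polynomial.C y)
    have hp : p.degree ≠ 0 := by
      have hd := Polynomial.degree_C_mul_X_pow (Fintype.card F) hc0
      rw [Polynomial.degree_sub_eq_left_of_degree_lt, hd]
      · exact_mod_cast Fintype.card_ne_zero (α := F)
      · rw [hd, Polynomial.degree_X_sub_C]
        exact_mod_cast hq
    obtain ⟨w, hw⟩ := IsAlgClosed.exists_root p hp
    obtain ⟨x, rfl⟩ := ih hs.2 w
    refine ⟨x, ?_⟩
    rw [expMap_cons_apply, ← hc]
    simp only [p, Polynomial.IsRoot, Polynomial.eval_sub, Polynomial.eval_mul,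
      Polynomial.eval_C, Polynomial.eval_pow, Polynomial.eval_X] at hw
    linear_combination -hw

/-- A relation modulo the span of `s` is carried by `expMap F s`, which kills that span, to a
relation among the images. -/
theorem LatticeIndep.append {s s' : List K} (hs : LatticeIndep F s)
    (hs' : LatticeIndep F (s'.map (expMap F s))) : LatticeIndep F (s' ++ s) := by
  have key (l : List K) {v : K} (hv : v ∈ latticeSpan F (l ++ s)) :
      expMap F s v ∈ latticeSpan F (l.map (expMap F s)) := by
    induction l generalizing v with
    | nil => exact mem_latticeSpan_nil.2 ((expMap_eq_zero_iff hs).2 hv)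
    | cons t l ih =>
      obtain ⟨w, hw, a, rfl⟩ := mem_latticeSpan_cons.1 hv
      exact mem_latticeSpan_cons.2 ⟨_, ih hw, a, by simp⟩
  induction s' with
  | nil => exact hs
  | cons t s' ih => exact ⟨fun h => hs'.1 (key s' h), ih hs'.2⟩

end Exponential

/-! Expansions in Laurent series. -/

section Laurent

variable {K : Type*} [Field K] [Algebra F K]

variable (F K) in
/-- Power series as Laurent series. -/
def laurent : PowerSeries K →ₐ[F] LaurentSeries K :=
  { HahnSeries.ofPowerSeries ℤ K with commutes' := fun _ => rfl }

variable (F K) in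
/-- Constants as Laurent series. -/
def laurentC : K →ₐ[F] LaurentSeries K :=
  (laurent F K).comp (IsScalarTower.toAlgHom F K (PowerSeries K))

theorem laurentC_apply (a : K) : laurentC F K a = laurent F K (PowerSeries.C a) := rfl

theorem laurent_injective : Function.Injective (laurent F K) :=
  HahnSeries.ofPowerSeries_injective

theorem laurent_X_sub_C_ne_zero (a : K) :
    laurent F K PowerSeries.X - laurentC F K a ≠ 0 := by
  rw [laurentC_apply, ← map_sub, ne_eq, map_eq_zero_iff _ laurent_injective]
  intro h
  simpa using congrArg (PowerSeries.coeff 1) h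

theorem laurent_X_notMem (s : List K) (a : K) :
    laurentC F K a - laurent F K PowerSeries.X ∉ latticeSpan F (s.map (laurentC F K)) := by
  rw [mem_latticeSpan_map]
  rintro ⟨v, -, hv⟩
  refine laurent_X_sub_C_ne_zero (F := F) (a - v) ?_
  rw [map_sub, hv]
  ring

theorem mk_inv_pow_mul {a : K} (ha : a ≠ 0) :
    PowerSeries.mk (fun n => a⁻¹ ^ (n + 1)) * (PowerSeries.C a - PowerSeries.X) = 1 := by
  ext n
  cases n with
  | zero => simp [ha, mul_sub]
  | succ n =>
    simp [mul_sub, PowerSeries.coeff_succ_mul_X, PowerSeries.coeff_one, pow_succ, ha,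
      mul_comm a⁻¹]

variable (F) in
/-- The generating series `1 - ∑ z ^ n ∑ 1 / v ^ n` of the power sums of the lattice. -/
def latticeSeries (s : List K) : PowerSeries K :=
  PowerSeries.mk fun n => if n = 0 then 1 else -latticeSum F s fun v => v⁻¹ ^ n

theorem coeff_latticeSum (s : List K) (f : K → PowerSeries K) (n : ℕ) :
    PowerSeries.coeff n (latticeSum F s f) = latticeSum F s fun v => PowerSeries.coeff n (f v) :=
  map_latticeSum (PowerSeries.coeff (R := K) n) s f

/-- With `z` the series variable, `z / e(z) = ∑ z / (z + v)` by the logarithmic derivative; the term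
`v = 0` gives `1` and the others are geometric series. -/
theorem laurent_latticeSeries {s : List K} (hs : LatticeIndep F s) :
    laurent F K PowerSeries.X = laurent F K (latticeSeries F s) *
      expMap F (s.map (laurentC F K)) (laurent F K PowerSeries.X) := by
  classical
  have hX : laurent F K PowerSeries.X ∉ latticeSpan F (s.map (laurentC F K)) := fun h =>
    laurent_X_notMem (F := F) s 0 (by simpa using Submodule.neg_mem _ h)
  have he := (expMap_eq_zero_iff (hs.map (laurentC F K))).not.2 hX
  rw [← div_eq_iff he, div_eq_mul_inv, ← latticeSum_inv_add (hs.map _) hX]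
  rw [show s.map (laurentC F K) = s.map (laurentC F K).toLinearMap from rfl, latticeSum_map,
    mul_latticeSum]
  have key (v : K) : laurent F K PowerSeries.X *
      (laurent F K PowerSeries.X + laurentC F K v)⁻¹ =
        laurent F K (PowerSeries.mk fun n =>
          if n = 0 then (if v = 0 then 1 else 0) else -(-v)⁻¹ ^ n) := by
    have h0 := laurent_X_sub_C_ne_zero (F := F) (-v)
    rw [map_neg, sub_neg_eq_add] at h0
    rw [← div_eq_mul_inv, div_eq_iff h0, laurentC_apply, ← map_add, ← map_mul]
    congr 1
    by_cases hv : v = 0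
    · have e : (PowerSeries.mk fun n => if n = 0 then (if v = 0 then 1 else 0) else -(-v)⁻¹ ^ n) =
          1 := by
        ext n
        by_cases hn : n = 0 <;> simp [hn, hv, PowerSeries.coeff_one]
      rw [e, hv, map_zero, add_zero, one_mul]
    · have e : (PowerSeries.mk fun n => if n = 0 then (if v = 0 then 1 else 0) else -(-v)⁻¹ ^ n) =
          -(PowerSeries.X * PowerSeries.mk fun n => (-v)⁻¹ ^ (n + 1)) := by
        ext n
        cases n with
        | zero => simp [hv]
        | succ n => simp [PowerSeries.coeff_succ_X_mul]
      have h := mk_inv_pow_mul (neg_ne_zero.2 hv)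
      rw [map_neg] at h
      rw [e]
      linear_combination -PowerSeries.X * h
  simp only [AlgHom.toLinearMap_apply, key]
  rw [← map_latticeSum]
  congr 1
  ext n
  rw [coeff_latticeSum, latticeSeries]
  simp only [PowerSeries.coeff_mk]
  split_ifs
  · exact latticeSum_ite_eq_zero hs fun _ => 1
  · refine (latticeSum_neg (F := F) s fun v : K => -v⁻¹ ^ n).trans ?_
    exact (map_latticeSum (negAddMonoidHom (α := K)) s _).symm

/-- The generating series is `∑ 1 / (x + v - z) = 1 / (e(x) - e(z))`. Writing `D` for `latticeSeries
F s` and substituting `e(z) = z / D` clears the denominator. -/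
theorem powSum_series {s : List K} (hs : LatticeIndep F s) {x : K} (hx : x ∉ latticeSpan F s) :
    PowerSeries.mk (fun n => powSum F s x (n + 1)) *
      (PowerSeries.C (expMap F s x) * latticeSeries F s - PowerSeries.X) = latticeSeries F s := by
  have hL := hs.map (laurentC F K)
  apply laurent_injective (F := F)
  have e : laurent F K (PowerSeries.mk fun n => powSum F s x (n + 1)) =
      (laurentC F K (expMap F s x) - expMap F (s.map (laurentC F K)) (laurent F K PowerSeries.X))⁻¹
      := by
    rw [← expMap_map, ← map_sub, ← latticeSum_inv_add hL (laurent_X_notMem s x),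
      show s.map (laurentC F K) = s.map (laurentC F K).toLinearMap from rfl, latticeSum_map]
    have e' : PowerSeries.mk (fun n => powSum F s x (n + 1)) =
        latticeSum F s fun v => PowerSeries.mk fun n => (x + v)⁻¹ ^ (n + 1) := by
      ext n
      simp [coeff_latticeSum, powSum]
    rw [e', map_latticeSum]
    refine latticeSum_congr fun v hv => ?_
    have h := congrArg (laurent F K) (mk_inv_pow_mul (add_ne_zero_of_notMem hx hv))
    rw [map_mul, map_one, map_sub, ← laurentC_apply] at h
    rw [eq_inv_of_mul_eq_one_left h]
    congr 1
    simp
    ring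
  have h0 : laurentC F K (expMap F s x) -
      expMap F (s.map (laurentC F K)) (laurent F K PowerSeries.X) ≠ 0 := by
    rw [← expMap_map, ← map_sub]
    exact (expMap_eq_zero_iff hL).not.2 (laurent_X_notMem s x)
  have hl := laurent_latticeSeries hs
  rw [map_mul, e, map_sub, map_mul, ← laurentC_apply]
  generalize expMap F (s.map (laurentC F K)) (laurent F K PowerSeries.X) = z at *
  rw [hl, mul_comm (laurentC F K _), ← mul_sub, mul_left_comm, inv_mul_cancel₀ h0, mul_one]

theorem powSum_eq_sum {s : List K} (hs : LatticeIndep F s) {x : K} (hx : x ∉ latticeSpan F s)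
    (n : ℕ) : powSum F s x (n + 1) = ∑ r ∈ Finset.range (n + 1),
      (expMap F s x)⁻¹ ^ (r + 1) * PowerSeries.coeff (n - r) ((latticeSeries F s)⁻¹ ^ r) := by
  have h := powSum_series hs hx
  have hc : PowerSeries.constantCoeff (latticeSeries F s) ≠ 0 := by
    rw [← PowerSeries.coeff_zero_eq_constantCoeff_apply]
    simp [latticeSeries]
  have hB := PowerSeries.mul_inv_cancel _ hc
  have he := (expMap_eq_zero_iff hs).not.2 hx
  set A := PowerSeries.mk fun n => powSum F s x (n + 1)
  set D := latticeSeries F s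
  set y := expMap F s x
  have hy : PowerSeries.C y⁻¹ * PowerSeries.C y = 1 := by
    rw [← map_mul, inv_mul_cancel₀ he, map_one]
  -- Fixed-point form of `h`. Iterating it gives a geometric expansion whose remainder after `n + 1`
  -- steps does not reach degree `n`.
  have h1 : A = PowerSeries.C y⁻¹ + PowerSeries.C y⁻¹ * D⁻¹ * PowerSeries.X * A := by
    linear_combination PowerSeries.C y⁻¹ * D⁻¹ * h - A * hy +
      (PowerSeries.C y⁻¹ - A * PowerSeries.C y⁻¹ * PowerSeries.C y) * hB
  have h2 (N : ℕ) : A = (∑ r ∈ Finset.range N,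
      PowerSeries.C (y⁻¹ ^ (r + 1)) * (D⁻¹ ^ r * PowerSeries.X ^ r)) +
        PowerSeries.C (y⁻¹ ^ N) * D⁻¹ ^ N * A * PowerSeries.X ^ N := by
    induction N with
    | zero => simp
    | succ N ih =>
      rw [Finset.sum_range_succ]
      simp only [map_pow] at ih ⊢
      linear_combination ih + PowerSeries.C y⁻¹ ^ N * D⁻¹ ^ N * PowerSeries.X ^ N * h1
  have h3 := congrArg (PowerSeries.coeff n) (h2 (n + 1))
  rw [map_add, map_sum, PowerSeries.coeff_mul_X_pow', if_neg (by lia), add_zero] at h3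
  simp only [A, PowerSeries.coeff_mk] at h3
  rw [h3]
  refine Finset.sum_congr rfl fun r hr => ?_
  rw [PowerSeries.coeff_C_mul, PowerSeries.coeff_mul_X_pow', if_pos (by simp at hr; lia)]

/-- The series with coefficients `∑ g |a| f(a₁) ⋯ f(aₘ)` over the words `a` of given weight. -/
def sigmaSeries (f : ℕ → K) (g : ℕ → K) : PowerSeries K :=
  PowerSeries.mk fun w => ∑ a ∈ sigmaWords w, g a.length * (a.map fun i : ℕ+ => f i).prod

/-- Splits off the first letter of a nonempty word. -/
theorem sigmaSeries_eq (f g : ℕ → K) :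
    sigmaSeries f g = PowerSeries.C (g 0) +
      PowerSeries.mk (fun n => if n = 0 then 0 else f n) * sigmaSeries f fun m => g (m + 1) := by
  ext w
  cases w with
  | zero =>
    have h : sigmaWords 0 = {[]} := by
      ext a
      rw [mem_sigmaWords]
      cases a <;> simp
    simp [sigmaSeries, h]
  | succ w =>
    simp only [sigmaSeries, map_add, PowerSeries.coeff_mk, PowerSeries.coeff_mul, Finset.mul_sum]
    rw [PowerSeries.coeff_C, if_neg w.succ_ne_zero, zero_add, Finset.sum_sigma']
    refine Finset.sum_of_injOn (fun a => ⟨(a.head?.elim 0 fun i : ℕ+ => (i : ℕ),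
      (a.tail.map fun i : ℕ+ => (i : ℕ)).sum), a.tail⟩) ?_ ?_ ?_ ?_
    · intro a ha b hb h
      rw [Finset.mem_coe, mem_sigmaWords] at ha hb
      match a, b with
      | [], _ => simp at ha
      | _ :: _, [] => simp at hb
      | i :: a, j :: b =>
        simp only [List.head?_cons, Option.elim_some, List.tail_cons, Sigma.mk.injEq,
          Prod.mk.injEq, PNat.coe_inj] at h
        rw [h.1.1, eq_of_heq h.2]
    · intro a ha
      rw [Finset.mem_coe, mem_sigmaWords] at ha
      match a with
      | [] => simp at ha
      | i :: a => simpa [mem_sigmaWords] using ha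
    · rintro ⟨⟨i, j⟩, a⟩ h hn
      by_cases hi : i = 0
      · simp [hi]
      · obtain ⟨i, rfl⟩ : ∃ k : ℕ+, (k : ℕ) = i := ⟨⟨i, Nat.pos_of_ne_zero hi⟩, rfl⟩
        obtain ⟨h1, h2⟩ := Finset.mem_sigma.1 h
        have h1' := Finset.HasAntidiagonal.mem_antidiagonal.1 h1
        rw [mem_sigmaWords] at h2
        refine absurd ⟨i :: a, ?_, ?_⟩ hn
        · rw [Finset.mem_coe, mem_sigmaWords, List.map_cons, List.sum_cons, h2]
          exact h1'
        · simp [h2]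
    · intro a ha
      rw [mem_sigmaWords] at ha
      match a with
      | [] => simp at ha
      | i :: a =>
        simp
        ring

/-- The negative binomial expansion of `(1 - U)⁻ʳ`, with `U` the generating series of the power
sums; words of length `m` enumerate the monomials of `U ^ m`. -/
theorem coeff_latticeSeries_inv_pow (s : List K) (r w : ℕ) :
    PowerSeries.coeff w ((latticeSeries F s)⁻¹ ^ r) = ∑ a ∈ sigmaWords w,
      ((r + a.length - 1).choose a.length : K) *
        (a.map fun i : ℕ+ => latticeSum F s fun v => v⁻¹ ^ (i : ℕ)).prod := by
  set f : ℕ → K := fun n => latticeSum F s fun v => v⁻¹ ^ n with hf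
  have hU : PowerSeries.mk (fun n => if n = 0 then 0 else f n) = 1 - latticeSeries F s := by
    ext n
    by_cases hn : n = 0 <;> simp [hn, latticeSeries, hf, PowerSeries.coeff_one]
  have hc : PowerSeries.constantCoeff (latticeSeries F s) ≠ 0 := by
    rw [← PowerSeries.coeff_zero_eq_constantCoeff_apply]
    simp [latticeSeries]
  have hB := PowerSeries.mul_inv_cancel _ hc
  have key (r : ℕ) : sigmaSeries f (fun m => ((r + m - 1).choose m : K)) =
      (latticeSeries F s)⁻¹ ^ r := by
    induction r with
    | zero =>
      rw [sigmaSeries_eq]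
      -- For `r = 0`, truncated subtraction gives `0.choose 0 = 1` on the empty word, while
      -- `m.choose (m + 1)` vanishes on all others.
      have h0 : sigmaSeries f (fun m => ((0 + (m + 1) - 1).choose (m + 1) : K)) = 0 := by
        ext w
        simp [sigmaSeries]
      rw [h0]
      simp
    | succ r ih =>
      have h1 := sigmaSeries_eq f fun m => ((r + 1 + m - 1).choose m : K)
      have h2 := sigmaSeries_eq f fun m => ((r + m - 1).choose m : K)
      have h3 : sigmaSeries f (fun m => ((r + 1 + (m + 1) - 1).choose (m + 1) : K)) =
          sigmaSeries f (fun m => ((r + 1 + m - 1).choose m : K)) +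
            sigmaSeries f (fun m => ((r + (m + 1) - 1).choose (m + 1) : K)) := by
        ext w
        simp only [sigmaSeries, map_add, PowerSeries.coeff_mk, ← Finset.sum_add_distrib, ← add_mul]
        refine Finset.sum_congr rfl fun a _ => ?_
        rw [show r + 1 + (a.length + 1) - 1 = (r + a.length) + 1 by lia,
          show r + 1 + a.length - 1 = r + a.length by lia,
          show r + (a.length + 1) - 1 = r + a.length by lia, Nat.choose_succ_succ', Nat.cast_add]
      rw [ih, hU] at h2
      rw [h3, hU] at h1
      simp only [Nat.choose_zero_right] at h1 h2
      set S := sigmaSeries f fun m => ((r + 1 + m - 1).choose m : K)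
      linear_combination (latticeSeries F s)⁻¹ * h1 - (latticeSeries F s)⁻¹ * h2 -
        S * hB
  rw [← key r, sigmaSeries, PowerSeries.coeff_mk]

end Laurent

/-! The coproduct under evaluation. -/

section Coproduct

variable {K L : Type*} [Field K] [Algebra F K] [Field L] [Algebra F L]

/-- The product of two functionals, as a functional on the tensor product. -/
def tensorEval (f g : WordSpace F →ₗ[F] K) : WordSpace F ⊗[F] WordSpace F →ₗ[F] K :=
  LinearMap.mul' F K ∘ₗ TensorProduct.map f g

@[simp] theorem tensorEval_tmul (f g : WordSpace F →ₗ[F] K) (a b : WordSpace F) :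
    tensorEval f g (a ⊗ₜ b) = f a * g b := rfl

theorem tensorEval_add_left (f f' g : WordSpace F →ₗ[F] K) :
    tensorEval (f + f') g = tensorEval f g + tensorEval f' g :=
  TensorProduct.ext' fun a b => by simp [add_mul]

theorem coproduct_word (u : Word F) : coproduct (word u) = coproductWord u := by
  simp [coproduct, word]

/-- The left factors of `reducedCoproductLetter` are single letters, so in the coproduct the
triangle product is just concatenation. -/
theorem triangle_letter (x : Letter F) (a : WordSpace F) :
    triangle (word [x]) a = consLetter x a := by
  have h : triangle (word [x]) = consLetter x := wordSpace_hom_ext fun w => by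
    rw [triangle, bilinExt_word, consLetter_word]
    cases w with
    | nil => rfl
    | cons y w => rw [triangleWord, shuffle_nil_left, consLetter_word]
  rw [h]

theorem shuffle_one (a : WordSpace F) : shuffle a (word []) = a := by
  have h : shuffle.flip (word ([] : Word F)) = LinearMap.id :=
    wordSpace_hom_ext fun w => by simp [shuffle_nil_right]
  exact LinearMap.congr_fun h a

theorem tensorProd_tmul (f g : WordSpace F →ₗ[F] WordSpace F →ₗ[F] WordSpace F)
    (a b a' b' : WordSpace F) :
    tensorProd F f g (a ⊗ₜ b) (a' ⊗ₜ b') = f a a' ⊗ₜ g b b' := rfl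

theorem coproductWord_cons (x : Letter F) (u : Word F) :
    coproductWord (x :: u) = word [] ⊗ₜ word (x :: u) +
      tensorProd F triangle shuffle (reducedCoproductLetter x) (coproductWord u) := by
  cases u with
  | nil =>
    rw [coproductWord, coproductWord, reducedCoproductLetter]
    simp only [map_sum, map_smul, LinearMap.sum_apply, LinearMap.smul_apply, tensorProd_tmul,
      triangle_letter, shuffle_one, consLetter_word]
  | cons y u => rw [coproductWord]

/-- Each letter weight `i` is at most the total weight, so the second binomial in `deltaCoeff`
vanishes and only the indicator of `q - 1 ∣ i` remains. The signs match those of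
`latticeSum_inv_pow`. -/
theorem zEval_bracket {s : List (K × ℕ)} (h : LatticeIndep F (s.map Prod.fst)) (a : List ℕ+) :
    zEval F s (bracket a) =
      (a.map fun i : ℕ+ => latticeSum F (s.map Prod.fst) fun v => v⁻¹ ^ (i : ℕ)).prod := by
  have h1 (b : List ℕ+) : zEval F s
      (b.foldr (fun i t => shuffle (word [((i, 1) : Letter F)]) t) (word [])) =
        (b.map fun i => zWord s [((i, 1) : Letter F)]).prod := by
    induction b with
    | nil => simp [zWord_nil]
    | cons i b ih => rw [List.foldr_cons, zEval_shuffle h, ih, zEval_word, List.map_cons,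
        List.prod_cons]
  have h2 (b : List ℕ+) (hb : ∀ i ∈ b, (i : ℕ) ≤ (a.map fun k : ℕ+ => (k : ℕ)).sum) :
      algebraMap F K ((-1) ^ b.length * (b.map fun i : ℕ+ =>
        deltaCoeff F 1 ((a.map fun k : ℕ+ => (k : ℕ)).sum + 1) (i : ℕ)).prod) *
          (b.map fun i => zWord s [((i, 1) : Letter F)]).prod =
        (b.map fun i : ℕ+ => latticeSum F (s.map Prod.fst) fun v => v⁻¹ ^ (i : ℕ)).prod := by
    induction b with
    | nil => simp
    | cons i b ih =>
      have hi := hb i (by simp)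
      have hi' := i.pos
      have hd : deltaCoeff F 1 ((a.map fun k : ℕ+ => (k : ℕ)).sum + 1) i =
          if (Fintype.card F - 1) ∣ (i : ℕ) then 1 else 0 := by
        rw [deltaCoeff, Nat.add_sub_cancel,
          Nat.choose_eq_zero_of_lt (show (i : ℕ) - 1 < (a.map fun k : ℕ+ => (k : ℕ)).sum by lia)]
        simp
      have ih' := ih fun k hk => hb k (by simp [hk])
      simp only [List.map_cons, List.prod_cons, List.length_cons, hd, latticeSum_inv_pow]
      simp only [latticeSum_inv_pow] at ih'
      rw [← ih']
      split_ifs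
      · simp only [map_mul, map_pow, map_neg, map_one]
        ring
      · simp
  rw [bracket, map_smul, h1, Algebra.smul_def, List.bind_eq_flatMap]
  simp only [List.pure_def, ← List.map_eq_flatMap, List.map_map]
  refine h2 a fun i hi => ?_
  exact List.single_le_sum (fun _ _ => Nat.zero_le _) _ (List.mem_map_of_mem hi)

theorem map_mem_latticeSpan_map_linear (e : K →ₗ[F] L) {l : List K} {v : K}
    (hv : v ∈ latticeSpan F l) : e v ∈ latticeSpan F (l.map e) := by
  induction l generalizing v with
  | nil => simpa [latticeSpan] using congrArg e (mem_latticeSpan_nil.1 hv)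
  | cons t l ih =>
    obtain ⟨w, hw, a, rfl⟩ := mem_latticeSpan_cons.1 hv
    exact mem_latticeSpan_cons.2 ⟨_, ih hw, a, by simp⟩

theorem tensorEval_levelEval_tensorProd {s s' : List (K × ℕ)}
    (hs : LatticeIndep F (s.map Prod.fst)) (t : K) (j : ℕ) (x : Letter F)
    (T : WordSpace F ⊗[F] WordSpace F) :
    tensorEval (levelEval F s' t j) (zEval F s)
        (tensorProd F triangle shuffle (reducedCoproductLetter x) T) =
      tensorEval (levelEval F s' t j) (zEval F s) (reducedCoproductLetter x) *
        tensorEval (zEval F s') (zEval F s) T := by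
  simp only [reducedCoproductLetter, map_sum, LinearMap.sum_apply, map_smul, LinearMap.smul_apply,
    Finset.sum_mul, smul_mul_assoc]
  refine Finset.sum_congr rfl fun r _ => Finset.sum_congr rfl fun a _ => ?_
  congr 1
  have h := TensorProduct.ext' (g := tensorEval (levelEval F s' t j) (zEval F s) ∘ₗ
      tensorProd F triangle shuffle (word [(r, x.2)] ⊗ₜ bracket a))
    (h := LinearMap.mulLeft F (tensorEval (levelEval F s' t j) (zEval F s)
      (word [(r, x.2)] ⊗ₜ bracket a)) ∘ₗ tensorEval (zEval F s') (zEval F s)) fun b c => by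
      simp only [LinearMap.comp_apply, tensorProd_tmul, triangle_letter, tensorEval_tmul,
        levelEval_consLetter, zEval_shuffle hs, LinearMap.mulLeft_apply, levelEval_word, levelWord,
        zWord_nil]
      ring
  exact LinearMap.congr_fun h T

/-- The reduced coproduct of a letter, evaluated at the images under `expMap` of the upper part of a
system and at its lower part `s`, gives the value of the letter at the whole system. -/
theorem tensorEval_reducedCoproductLetter {s s' : List (K × ℕ)}
    (hs : LatticeIndep F (s.map Prod.fst)) {t : K} {j : ℕ}
    (h : LatticeIndep F ((t :: s'.map Prod.fst).map (expMap F (s.map Prod.fst)))) (x : Letter F) :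
    tensorEval (levelEval F (s'.map (Prod.map (expMap F (s.map Prod.fst)) id))
      (expMap F (s.map Prod.fst) t) j) (zEval F s) (reducedCoproductLetter x) =
        letterValue (s' ++ s) t j x := by
  have h1 (n : ℕ) : powSum F ((s' ++ s).map Prod.fst) t (n + 1) =
      ∑ r ∈ Finset.range (n + 1), powSum F ((s'.map (Prod.map (expMap F (s.map Prod.fst)) id)).map
        Prod.fst) (expMap F (s.map Prod.fst) t) (r + 1) *
          PowerSeries.coeff (n - r) ((latticeSeries F (s.map Prod.fst))⁻¹ ^ r) := by
    -- The lattice of `s' ++ s` is summed in fibres over that of `s'`. Each fibre is a power sum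
    -- over `s` at `t + v`, and additivity of `expMap` puts the result in the form of a power sum
    -- over the image of `s'`.
    have e (v : K) (hv : v ∈ latticeSpan F (s'.map Prod.fst)) :
        latticeSum F (s.map Prod.fst) (fun u => (t + (v + u))⁻¹ ^ (n + 1)) =
          ∑ r ∈ Finset.range (n + 1), (expMap F (s.map Prod.fst) t +
            expMap F (s.map Prod.fst) v)⁻¹ ^ (r + 1) *
              PowerSeries.coeff (n - r) ((latticeSeries F (s.map Prod.fst))⁻¹ ^ r) := by
      rw [← map_add, ← powSum_eq_sum hs, powSum]
      · simp only [add_assoc]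
      · intro hm
        have hm' := (expMap_eq_zero_iff hs).2 hm
        rw [map_add] at hm'
        refine add_ne_zero_of_notMem h.1 ?_ hm'
        exact map_mem_latticeSpan_map_linear _ hv
    have e' : (s'.map (Prod.map (expMap F (s.map Prod.fst)) id)).map Prod.fst =
        (s'.map Prod.fst).map (expMap F (s.map Prod.fst)) := by
      simp [Function.comp_def]
    rw [powSum, List.map_append, latticeSum_append, latticeSum_congr e, latticeSum_sum, e']
    refine Finset.sum_congr rfl fun r _ => ?_
    rw [powSum, latticeSum_map, latticeSum_mul]
  obtain ⟨n, hn⟩ := Nat.exists_eq_succ_of_ne_zero x.1.ne_zero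
  rw [reducedCoproductLetter, map_sum, letterValue, hn, h1, Finset.mul_sum]
  symm
  refine Finset.sum_bij (fun r _ => r.succPNat) ?_ ?_ ?_ ?_
  · intro r hr
    rw [Finset.mem_range] at hr
    rw [Finset.mem_Icc, ← PNat.coe_le_coe, ← PNat.coe_le_coe, hn]
    simp
    lia
  · intro r _ r' _ hr
    exact Nat.succPNat_injective hr
  · intro r hr
    rw [Finset.mem_Icc, ← PNat.coe_le_coe, ← PNat.coe_le_coe, hn] at hr
    refine ⟨r.natPred, ?_, by simp⟩
    have := PNat.natPred_add_one r
    simp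
    lia
  · intro r hr
    rw [coeff_latticeSeries_inv_pow, map_sum, Finset.mul_sum, Finset.mul_sum]
    refine Finset.sum_congr (by simp) fun a _ => ?_
    rw [map_smul, tensorEval_tmul, levelEval_word, levelWord,
      zWord_nil, mul_one, zEval_bracket hs, letterValue, Algebra.smul_def, map_natCast,
      -- The letter index is `r + 1`; for `r = 0` and empty `a` both truncated differences are `0`.
      show ((r.succPNat : ℕ+) : ℕ) + a.length - 2 = r + a.length - 1 by simp; lia]
    simp
    ring

/-- The coproduct corresponds to the splitting of a system into an upper and a lower part. -/
theorem tensorEval_coproduct {s s' : List (K × ℕ)} (hs : LatticeIndep F (s.map Prod.fst))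
    (h : LatticeIndep F ((s'.map Prod.fst).map (expMap F (s.map Prod.fst)))) (a : WordSpace F) :
    tensorEval (zEval F (s'.map (Prod.map (expMap F (s.map Prod.fst)) id))) (zEval F s)
      (coproduct a) = zEval F (s' ++ s) a := by
  refine LinearMap.congr_fun (f := tensorEval _ _ ∘ₗ coproduct) (g := zEval F (s' ++ s))
    (wordSpace_hom_ext fun w => ?_) a
  rw [LinearMap.comp_apply, coproduct_word]
  induction s' generalizing w with
  | nil =>
    cases w with
    | nil => simp [coproductWord, zWord_nil]
    | cons x u =>
      -- With an empty upper system every term whose left factor starts with a letter vanishes,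
      -- leaving only `1 ⊗ w`.
      have h0 : tensorEval (zEval F ([] : List (K × ℕ))) (zEval F s)
          ∘ₗ tensorProd F triangle shuffle (reducedCoproductLetter x) = 0 := by
        refine TensorProduct.ext' fun b c => ?_
        simp [reducedCoproductLetter, tensorProd_tmul, triangle_letter, zEval_nil_consLetter]
      have h1 := LinearMap.congr_fun h0 (coproductWord u)
      rw [LinearMap.comp_apply, LinearMap.zero_apply] at h1
      rw [coproductWord_cons, List.map_nil, map_add, h1]
      simp [zWord]
  | cons p s' ih =>
    obtain ⟨t, j⟩ := p
    have ih' := ih h.2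
    cases w with
    | nil => simp [coproductWord, zWord_nil]
    | cons x u =>
      rw [List.map_cons, Prod.map_apply, id, zEval_cons, tensorEval_add_left, LinearMap.add_apply,
        ih', List.cons_append, zEval_cons, LinearMap.add_apply, levelEval_word, levelWord,
        coproductWord_cons, map_add, tensorEval_levelEval_tensorProd hs, ih',
        tensorEval_reducedCoproductLetter hs h]
      simp [levelWord]

end Coproduct

/-! Words are separated by their values at all systems. -/

section Faithful

variable {K : Type u} [Field K] [Algebra F K]

variable (K) in
/-- Taking the coefficient of the Laurent series at an integer. -/
def laurentCoeff (n : ℤ) : LaurentSeries K →+ K where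
  toFun f := f.coeff n
  map_zero' := rfl
  map_add' _ _ := rfl

theorem laurentCoeff_laurentC_mul (n : ℤ) (a : K) (f : LaurentSeries K) :
    laurentCoeff K n (laurentC F K a * f) = a * laurentCoeff K n f := by
  have h : laurentC F K a = HahnSeries.C a := HahnSeries.ofPowerSeries_C a
  rw [h, HahnSeries.C_mul_eq_smul]
  rfl

theorem laurentCoeff_laurent {n : ℤ} (hn : n < 0) (f : PowerSeries K) :
    laurentCoeff K n (laurent F K f) = 0 := by
  change (HahnSeries.ofPowerSeries ℤ K f).coeff n = 0
  rw [HahnSeries.ofPowerSeries_apply]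
  refine HahnSeries.embDomain_of_notMem_range ?_
  rintro ⟨m, rfl⟩
  simp at hn
  lia

/-- Only the lattice vector `0` produces a pole at the origin, namely `X⁻ᵐ`; the other terms are
power series. -/
theorem laurentCoeff_powSum {s : List K} (hs : LatticeIndep F s) (m n : ℕ+) :
    laurentCoeff K (-(n : ℤ)) (powSum F (s.map (laurentC F K)) (laurent F K PowerSeries.X) m) =
      if m = n then 1 else 0 := by
  classical
  have key (v : K) : laurentCoeff K (-(n : ℤ))
      ((laurent F K PowerSeries.X + laurentC F K v)⁻¹ ^ (m : ℕ)) =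
        if v = 0 then (if m = n then 1 else 0) else 0 := by
    by_cases hv : v = 0
    · have hX : laurent F K PowerSeries.X = HahnSeries.single 1 1 := HahnSeries.ofPowerSeries_X
      rw [hv, map_zero, add_zero, hX, HahnSeries.inv_single, HahnSeries.single_pow]
      change (HahnSeries.single _ _).coeff _ = _
      rw [HahnSeries.coeff_single]
      simp [eq_comm, PNat.coe_inj]
    · rw [if_neg hv]
      have h := congrArg (laurent F K) (mk_inv_pow_mul (neg_ne_zero.2 hv))
      rw [map_mul, map_one, map_sub, ← laurentC_apply, map_neg, ← neg_add', mul_neg,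
        ← neg_mul] at h
      rw [add_comm, ← eq_inv_of_mul_eq_one_left h, ← map_neg, ← map_pow]
      exact laurentCoeff_laurent (by simp) _
  rw [powSum, map_latticeSum]
  refine (latticeSum_map (laurentC F K).toLinearMap s _).trans ?_
  simp only [AlgHom.toLinearMap_apply, key]
  exact latticeSum_ite_eq_zero hs fun _ => if m = n then 1 else 0

/-- A Vandermonde argument at the distinct points `ε`. It explains the exponent `j` in a system:
varying it separates letters of equal weight. -/
theorem eq_zero_of_sum_pow_mul_eq_zero [Fintype Fˣ] {f : Fˣ → K}
    (h : ∀ j : ℕ, ∑ ε : Fˣ, algebraMap F K ((ε : F) ^ j) * f ε = 0) (ε : Fˣ) : f ε = 0 := by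
  have e := Fintype.equivFin Fˣ
  have h0 := Matrix.eq_zero_of_forall_pow_sum_mul_pow_eq_zero (v := fun i => f (e.symm i))
    (f := fun i => algebraMap F K (e.symm i : F))
    (fun i j hij => e.symm.injective (Units.ext ((algebraMap F K).injective hij))) fun i => by
      rw [← h i, ← e.symm.sum_comp]
      refine Finset.sum_congr rfl fun k _ => ?_
      rw [map_pow, mul_comm]
  simpa using congrFun h0 (e ε)

/-- The coefficient of the letter of weight `n` in the part of depth one at the top level. -/
theorem sum_eq_sum_comapDomain [Fintype Fˣ] {L : Type u} [Field L] [Algebra F L] (φ : K →ₐ[F] L)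
    (c : Word F →₀ K) (n : ℕ+) (j : ℕ) (f : Word F → L) (g : Word F → L) (hnil : g [] = 0)
    (hcons : ∀ x u, g (x :: u) = if x.1 = n then algebraMap F L ((x.2 : F) ^ j) * f u else 0) :
    (c.sum fun w a => φ a * g w) = ∑ ε : Fˣ, algebraMap F L ((ε : F) ^ j) *
      (c.comapDomain (List.cons ((n, ε) : Letter F)) List.cons_injective.injOn).sum
        fun u a => φ a * f u := by
  classical
  have hsum (c : Word F →₀ K) (g : Word F → L) (c' : Word F →₀ K) :
      ((c + c').sum fun w a => φ a * g w) =
        (c.sum fun w a => φ a * g w) + c'.sum fun w a => φ a * g w :=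
    Finsupp.sum_add_index' (by simp) (by simp [add_mul])
  induction c using Finsupp.induction_linear with
  | zero => simp
  | add c c' h h' =>
    rw [hsum, h, h', ← Finset.sum_add_distrib]
    refine Finset.sum_congr rfl fun ε _ => ?_
    rw [← mul_add, ← hsum, Finsupp.comapDomain_add_of_injective List.cons_injective]
  | single w a =>
    rw [Finsupp.sum_single_index (by simp)]
    have hs (ε : Fˣ) : (Finsupp.single w a).comapDomain (List.cons ((n, ε) : Letter F))
        List.cons_injective.injOn = match w with
          | [] => 0
          | x :: u => if x = (n, ε) then Finsupp.single u a else 0 := by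
      ext v
      rw [Finsupp.comapDomain_apply]
      cases w with
      | nil => simp
      | cons x u =>
        simp only [Finsupp.single_apply, List.cons.injEq]
        split_ifs <;> simp_all
    simp only [hs]
    cases w with
    | nil => simp [hnil]
    | cons x u =>
      obtain ⟨m, η⟩ := x
      rw [hcons]
      by_cases hm : m = n
      · rw [Finset.sum_eq_single η]
        · simp [hm]
          ring
        · intro ε _ hε
          simp [Ne.symm hε]
        · simp
      · simp [hm]

theorem LatticeIndep.map_prod {L : Type*} [Field L] [Algebra F L] (φ : K →ₐ[F] L)
    {s : List (K × ℕ)} (hs : LatticeIndep F (s.map Prod.fst)) :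
    LatticeIndep F ((s.map (Prod.map φ id)).map Prod.fst) := by
  have e : (s.map (Prod.map φ id)).map Prod.fst = (s.map Prod.fst).map φ := by
    simp [Function.comp_def]
  rw [e]
  exact hs.map φ

/-- The polar coefficients of the values at a system extended by the variable of Laurent series. -/
theorem laurentCoeff_levelWord {s : List (K × ℕ)} (hs : LatticeIndep F (s.map Prod.fst)) (n : ℕ+)
    (j : ℕ) (x : Letter F) (u : Word F) :
    laurentCoeff K (-(n : ℤ)) (levelWord (s.map (Prod.map (laurentC F K) id))
      (laurent F K PowerSeries.X) j (zWord (s.map (Prod.map (laurentC F K) id))) (x :: u)) =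
        if x.1 = n then algebraMap F K ((x.2 : F) ^ j) * zWord s u else 0 := by
  have e : (s.map (Prod.map (laurentC F K) id)).map Prod.fst =
      (s.map Prod.fst).map (laurentC F K) := by
    simp [Function.comp_def]
  rw [levelWord, map_zWord, letterValue, ← AlgHom.commutes (laurentC F K), mul_right_comm,
    ← map_mul, laurentCoeff_laurentC_mul, e, laurentCoeff_powSum hs]
  split_ifs <;> simp

/-- A combination of words which vanishes at all systems over all extensions is zero. -/
theorem eq_zero_of_sum_zWord_eq_zero (c : Word F →₀ K)
    (h : ∀ (L : Type u) [Field L] [Algebra F L] [IsAlgClosed L] (φ : K →ₐ[F] L) (s : List (L × ℕ)),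
      LatticeIndep F (s.map Prod.fst) → (c.sum fun w a => φ a * zWord s w) = 0) : c = 0 := by
  classical
  suffices H : ∀ (w : Word F) (c : Word F →₀ K), (∀ (L : Type u) [Field L] [Algebra F L]
      [IsAlgClosed L] (φ : K →ₐ[F] L) (s : List (L × ℕ)), LatticeIndep F (s.map Prod.fst) →
        (c.sum fun w a => φ a * zWord s w) = 0) → c w = 0 from
    Finsupp.ext fun w => H w c h
  clear h c
  intro w
  induction w with
  | nil =>
    intro c h
    -- At the empty system only the empty word has a nonzero value.
    have h0 := h (AlgebraicClosure K) (IsScalarTower.toAlgHom F K (AlgebraicClosure K)) [] trivial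
    rw [Finsupp.sum_eq_single []] at h0
    · simpa [zWord] using h0
    · intro w _ hw
      cases w with
      | nil => exact absurd rfl hw
      | cons x u => simp [zWord]
    · simp
  | cons x u ih =>
    intro c h
    obtain ⟨n, ε⟩ := x
    refine ih (c.comapDomain (List.cons (n, ε)) List.cons_injective.injOn)
      fun L _ _ _ φ s hs => ?_
    revert ε
    refine eq_zero_of_sum_pow_mul_eq_zero fun j => ?_
    set s₁ := s.map (Prod.map (laurentC F L) id) with hs₁
    -- The hypothesis speaks of algebraically closed fields only, so the system extended by the
    -- Laurent variable is tested in the closure and the result pulled back along the injection `ι`.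
    let ι := IsScalarTower.toAlgHom F (LaurentSeries L) (AlgebraicClosure (LaurentSeries L))
    have hs₁' : LatticeIndep F (((laurent F L PowerSeries.X, j) :: s₁).map Prod.fst) := by
      refine ⟨fun hX => ?_, hs.map_prod _⟩
      rw [hs₁, List.map_map] at hX
      refine laurent_X_notMem (F := F) (s.map Prod.fst) 0 ?_
      rw [map_zero, zero_sub, List.map_map]
      exact Submodule.neg_mem _ hX
    have h1 := h _ ((ι.comp (laurentC F L)).comp φ) _ (hs₁'.map_prod ι)
    simp only [map_zWord, AlgHom.comp_apply, ← map_mul, ← map_finsuppSum] at h1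
    have h3 := (map_eq_zero_iff ι ι.injective).1 h1
    -- Subtracting the vanishing at the lower system isolates the words whose first letter sits at
    -- the new variable; its coefficient at `-n` then selects weight `n`.
    have h4 : (c.sum fun w a => laurentC F L (φ a) * zWord s₁ w) = 0 := by
      simp only [hs₁, map_zWord, ← map_mul, ← map_finsuppSum, h L φ s hs, map_zero]
    simp only [zWord, mul_add, Finsupp.sum_add, h4, zero_add] at h3
    have h5 := congrArg (laurentCoeff L (-(n : ℤ))) h3
    rw [map_finsuppSum, map_zero] at h5
    simp only [laurentCoeff_laurentC_mul] at h5
    rw [← h5]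
    symm
    refine sum_eq_sum_comapDomain φ c n j (zWord s) (fun w => laurentCoeff L (-(n : ℤ))
      (levelWord s₁ (laurent F L PowerSeries.X) j (zWord s₁) w)) (map_zero _) fun x u => ?_
    exact laurentCoeff_levelWord hs n j x u

theorem zEval_map {L : Type u} [Field L] [Algebra F L] (φ : K →ₐ[F] L) (s : List (K × ℕ)) :
    zEval F (s.map (Prod.map φ id)) = φ.toLinearMap ∘ₗ zEval F s :=
  wordSpace_hom_ext fun w => by simp [map_zWord]

/-- Evaluating the right factor first leaves a combination of words with coefficients in `K`, the
form that `eq_zero_of_sum_zWord_eq_zero` handles. -/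
theorem tensorEval_eq_sum [DecidableEq (Word F)] {L : Type u} [Field L] [Algebra F L]
    (φ : K →ₐ[F] L) (s : List (K × ℕ)) (s' : List (L × ℕ)) (X : WordSpace F ⊗[F] WordSpace F) :
    tensorEval (zEval F s') (zEval F (s.map (Prod.map φ id))) X =
      ((TensorProduct.finsuppScalarLeft F (WordSpace F) (Word F) X).mapRange (zEval F s)
        (map_zero _)).sum fun w a => φ a * zWord s' w := by
  obtain ⟨Y, rfl⟩ := (TensorProduct.finsuppScalarLeft F (WordSpace F) (Word F)).symm.surjective X
  rw [LinearEquiv.apply_symm_apply, Finsupp.sum_mapRange_index (by simp)]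
  induction Y using Finsupp.induction_linear with
  | zero => simp
  | add Y Y' h h' =>
    rw [map_add, map_add, h, h', Finsupp.sum_add_index' (by simp) (by simp [add_mul])]
  | single w y =>
    rw [TensorProduct.finsuppScalarLeft_symm_apply_single, tensorEval_tmul, zEval_map,
      Finsupp.sum_single_index (by simp), mul_comm]
    congr 1
    exact zEval_word s' w

/-- Separation is used twice: first in the left factor, with the right one evaluated at a fixed
system, and then on each right coefficient. -/
theorem eq_zero_of_tensorEval_eq_zero (X : WordSpace F ⊗[F] WordSpace F)
    (h : ∀ (L : Type u) [Field L] [Algebra F L] [IsAlgClosed L] (s' s : List (L × ℕ)),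
      LatticeIndep F (s'.map Prod.fst) → LatticeIndep F (s.map Prod.fst) →
        tensorEval (zEval F s') (zEval F s) X = 0) : X = 0 := by
  classical
  set Y := TensorProduct.finsuppScalarLeft F (WordSpace F) (Word F) X with hY
  suffices hw : ∀ w, Y w = 0 by
    rw [← (TensorProduct.finsuppScalarLeft F (WordSpace F) (Word F)).map_eq_zero_iff, ← hY]
    exact Finsupp.ext hw
  have h1 (K : Type u) [Field K] [Algebra F K] [IsAlgClosed K] (s : List (K × ℕ))
      (hs : LatticeIndep F (s.map Prod.fst)) (w : Word F) : zEval F s (Y w) = 0 := by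
    have h2 := eq_zero_of_sum_zWord_eq_zero (Y.mapRange (zEval F s) (map_zero _))
      fun L _ _ _ φ s' hs' => by
        rw [← h L s' (s.map (Prod.map φ id)) hs' (hs.map_prod φ), tensorEval_eq_sum φ]
    simpa using DFunLike.congr_fun h2 w
  intro w
  refine eq_zero_of_sum_zWord_eq_zero (Y w) fun L _ _ _ φ s hs => ?_
  rw [← h1 L s hs w, zEval, Finsupp.linearCombination_apply]
  refine Finsupp.sum_congr fun v _ => ?_
  rw [Algebra.smul_def, ← φ.commutes]
  rfl

end Faithful

/-! ### Multiplicativity on the tensor square and conclusion. -/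

theorem tensorEval_tensorShuffle {K : Type*} [Field K] [Algebra F K] {s s' : List (K × ℕ)}
    (hs : LatticeIndep F (s.map Prod.fst)) (hs' : LatticeIndep F (s'.map Prod.fst))
    (X Y : WordSpace F ⊗[F] WordSpace F) :
    tensorEval (zEval F s') (zEval F s) (tensorShuffle X Y) =
      tensorEval (zEval F s') (zEval F s) X * tensorEval (zEval F s') (zEval F s) Y := by
  induction X with
  | zero => simp
  | add X X' h h' => rw [map_add, LinearMap.add_apply, map_add, h, h', map_add, add_mul]
  | tmul a b =>
    induction Y with
    | zero => simp
    | add Y Y' h h' => rw [map_add, map_add, h, h', map_add, mul_add]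
    | tmul c d =>
      rw [tensorShuffle_tmul, tensorEval_tmul, zEval_shuffle hs, zEval_shuffle hs']
      exact mul_mul_mul_comm ..

end AMZV

end

theorem mainTheorem2 {F : Type*} [Field F] [Fintype F] (u v : AMZV.Word F) :
    AMZV.coproduct (AMZV.shuffle (AMZV.word u) (AMZV.word v)) =
      AMZV.tensorShuffle (AMZV.coproduct (AMZV.word u)) (AMZV.coproduct (AMZV.word v)) := by
  rw [← sub_eq_zero]
  refine AMZV.eq_zero_of_tensorEval_eq_zero _ fun L _ _ _ s' s hs' hs => ?_
  -- The left system is lifted through `expMap`, so that the pair becomes the splitting of the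
  -- single system `s' ++ s`.
  obtain ⟨s', rfl⟩ : ∃ l : List (L × ℕ),
      l.map (Prod.map (AMZV.expMap F (s.map Prod.fst)) id) = s' :=
    List.map_surjective_iff.2 ((AMZV.expMap_surjective hs).prodMap Function.surjective_id) s'
  have hl : AMZV.LatticeIndep F ((s'.map Prod.fst).map (AMZV.expMap F (s.map Prod.fst))) := by
    simpa [Function.comp_def] using hs'
  have h : AMZV.LatticeIndep F ((s' ++ s).map Prod.fst) := by
    rw [List.map_append]
    exact hs.append hl
  rw [map_sub, AMZV.tensorEval_tensorShuffle hs hs', AMZV.tensorEval_coproduct hs hl,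
    AMZV.tensorEval_coproduct hs hl, AMZV.tensorEval_coproduct hs hl, AMZV.zEval_shuffle h, sub_self]
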